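/- **Setting.** If $E,F$ are normed spaces, $U\subset E$ is open and $f:U\to F$, let $\partial_x f(u)=\lim_{t\to0}t^{-1}(f(u+tx)-f(u))$ and, recursively, $\partial^{j}_{x_1\dots x_j}f=\partial_{x_j}(\partial^{j-1}_{x_1\dots x_{j-1}}f)$. If $E_0$ is a normed space continuously embedded in $E$, $\mathcal G^n(U,F;E_0)$ is the set of continuous $f:U\to F$ that are strongly continuously Gâteaux differentiable up to order $n$ with respect to $E_0$: for $j=1,\dots,n$ there are $j$-linear separately continuous maps $\partial^j_{E_0}f(u):E_0^j\to F$ ($u\in U$), with $\partial^0_{E_0} f=f$, such that, for all $x_1,\dots,x_j\in E_0$, $\partial^j_{E_0}f(u).(x_1,\dots,x_j)$ is the directional derivative of $\partial^{j-1}_{E_0}f(\cdot).(x_1,\dots,x_{j-1})$ at $u$ for the increment $x_j$, and is continuous in $u\in U$. We write $\mathcal G^n(U,F)=\mathcal G^n(U,F;E)$. Let $n\ge1$, $\alpha\in[0,1)$, let $X$ be a real Banach space, $U\subset X$ open, and let $Y_1\supset Y_2\supset\dots\supset Y_n$ be real Banach spaces with norms $|\cdot|_1,\dots,|\cdot|_n$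 and continuous inclusions. We say that $h_1:U\times Y_1\to Y_1$ satisfies Assumption (A) if $h_1(U\times Y_k)\subset Y_k$ for $k=2,\dots,n$ and, denoting by $h_k:U\times Y_k\to Y_k$ the induced functions, 1. for $k=1,\dots,n$, $h_k$ is continuous and $|h_k(u,y)-h_k(u,y')|_k\le\alpha|y-y'|_k$ for all $u\in U$, $y,y'\in Y_k$; 2. for $k=1,\dots,n$, $h_k\in\mathcal G^1(U\times Y_k,Y_k;\{0\}\times Y_k)$ and $h_k\in\mathcal G^n(U\times Y_k,Y_k;X\times\{0\})$; 3. for $k=1,\dots,n-1$, $h_k\in\mathcal G^n(U\times Y_k,Y_k;X\times Y_{k+1})$; 4. for $k=1,\dots,n$, $j=1,\dots,n-1$ and every permutation $\sigma$ of $\{1,\dots,j+1\}$, the derivative $\partial^{j+1}_{z_{\sigma(1)}\dots z_{\sigma(j+1)}}h_k(u,y)$ exists for all $u\in U$, $y\in Y_k$, $z_1,\dots,z_j\in X$, $z_{j+1}\in Y_k$, and is jointly continuous in $(u,y,z_1,\dots,z_{j+1})\in U\times Y_k\times X^j\times Y_k$ with values in $Y_k$. (Elements of $X$ and of $Y_k$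 are used as increments through $x\mapsto(x,0)$ and $y\mapsto(0,y)$.) The fixed-point map of $h_1$ is the unique $\varphi:U\to Y_1$ with $h_1(u,\varphi(u))=\varphi(u)$ for all $u\in U$. **Proposition.** Let $h_1$ and $h_1^{(1)},h_1^{(2)},\dots$ satisfy Assumption (A), with the same $n,\alpha,X,U,Y_1,\dots,Y_n$, let $h_k$, $h_k^{(m)}$ be the induced functions, and let $\varphi,\varphi^{(m)}$ be the fixed-point maps of $h_1,h_1^{(m)}$. Suppose that, as $m\to\infty$, (i) for $k=1,\dots,n$ and every $y\in Y_k$, $h^{(m)}_k(u,y)\to h_k(u,y)$ in $Y_k$, uniformly for $u$ on compact subsets of $U$; (ii) for $k=1,\dots,n$, $\partial_xh_k^{(m)}(u,y)\to\partial_xh_k(u,y)$ and $\partial_yh_k^{(m)}(u,y')\to\partial_yh_k(u,y')$ in $Y_k$, uniformly for $u$ on compact subsets of $U$, $x$ on compact subsets of $X$, and $y,y'$ on compact subsets of $Y_k$; (iii) for $k=1,\dots,n-1$ and $j,i\ge0$ with $1\le j+i\le n$, $\partial^{j+i}_{x_1\dots x_jy_1\dots y_i}h_k^{(m)}(u,y)\to\partial^{j+i}_{x_1\dots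 x_jy_1\dots y_i}h_k(u,y)$ in $Y_k$, uniformly for $u$ on compact subsets of $U$, $x_1,\dots,x_j$ on compact subsets of $X$, $y$ on compact subsets of $Y_k$, and $y_1,\dots,y_i$ on compact subsets of $Y_{k+1}$. Then $\varphi$ and all the $\varphi^{(m)}$ take values in $Y_n$, and $\varphi^{(m)}\to\varphi$ in $Y_n$, uniformly on compact subsets of $U$. Moreover, for $j=1,\dots,n$, $\varphi$ and all the $\varphi^{(m)}$ belong to $\mathcal G^j(U,Y_{n-j+1})$, and $$\lim_{m\to\infty}\partial^j_{x_1\dots x_j}\varphi^{(m)}(u)=\partial^j_{x_1\dots x_j}\varphi(u)\quad\text{in }Y_{n-j+1},$$ uniformly for $u$ on compact subsets of $U$ and $x_1,\dots,x_j$ on compact subsets of $X$. -/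

import Mathlib

open Set Filter Topology

noncomputable section

/-- The iterated directional derivative `∂^j_{x₁ … x_j} f`, for the list of increments
`[x₁, …, x_j]`: one first takes the directional derivative for the increment `x₁`, then the
directional derivative of the result for the increment `x₂`, and so on. -/
def iterDirDeriv {E F : Type*} [AddCommGroup E] [Module ℝ E]
    [NormedAddCommGroup F] [NormedSpace ℝ F] : List E → (E → F) → E → F
  | [], f => f
  | x :: l, f => iterDirDeriv l (fun u => lineDeriv ℝ f u x)

/-- The iterated directional derivative `∂^j_{x₁ … x_j} f(u)`, for the list of increments
`[x₁, …, x_j]`, exists at every point `u` of the (open) set `U`. -/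
def IterDirDifferentiableOn {E F : Type*} [AddCommGroup E] [Module ℝ E]
    [NormedAddCommGroup F] [NormedSpace ℝ F] (U : Set E) : List E → (E → F) → Prop
  | [], _ => True
  | x :: l, f => (∀ u ∈ U, LineDifferentiableAt ℝ f u x) ∧
      IterDirDifferentiableOn U l (fun u => lineDeriv ℝ f u x)

/-- The class `𝒢ⁿ(U, F; E₀)` of functions that are continuous on the open set `U ⊆ E` and strongly
continuously Gâteaux differentiable up to order `n` with respect to `E₀`, a space which is
continuously embedded into `E` by `e`.

`D j u` is the `j`-th Gâteaux differential of `f` at `u`. It is an element of `L_s^{(j)}(E₀^j, F)`,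
the space of the `j`-linear separately continuous maps, whose topology is the one of pointwise
convergence. Hence both the limit defining the directional derivatives of `D j` and the
continuity of `u ↦ D j u` are tested at each `v ∈ E₀^j`. -/
def IsStronglyGateaux {E₀ E F : Type*}
    [NormedAddCommGroup E₀] [NormedSpace ℝ E₀] [NormedAddCommGroup E] [NormedSpace ℝ E]
    [NormedAddCommGroup F] [NormedSpace ℝ F]
    (n : ℕ) (e : E₀ →L[ℝ] E) (U : Set E) (f : E → F) : Prop :=
  ∃ D : (j : ℕ) → E → MultilinearMap ℝ (fun _ : Fin j => E₀) F,
    (∀ u ∈ U, ∀ v : Fin 0 → E₀, D 0 u v = f u) ∧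
    (∀ j ≤ n, ∀ u ∈ U, ∀ (v : Fin j → E₀) (i : Fin j),
      Continuous fun x : E₀ => D j u (Function.update v i x)) ∧
    (∀ j ≤ n, ∀ v : Fin j → E₀, ContinuousOn (fun u => D j u v) U) ∧
    (∀ j < n, ∀ u ∈ U, ∀ (v : Fin j → E₀) (x : E₀),
      HasLineDerivAt ℝ (fun w => D j w v) (D (j + 1) u (Fin.snoc v x)) u (e x))

/-- The increments `z₁, …, z_j ∈ X` and `z_{j+1} ∈ Z`, seen as elements of `X × Z`. -/
def mixedIncrements {X Z : Type*} [Zero X] [Zero Z] {j : ℕ} (z : Fin j → X) (z' : Z) :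
    Fin (j + 1) → X × Z :=
  Fin.snoc (α := fun _ => X × Z) (fun l => (z l, 0)) (0, z')

/-- The standing assumptions on a parametric contraction `h₁` of order `n`.

The decreasing sequence of Banach spaces `Y₁ ⊃ Y₂ ⊃ … ⊃ Y_n` is given by the spaces `Y k`,
`1 ≤ k ≤ n`, with the continuous linear injections `ι k : Y (k + 1) → Y k`, `1 ≤ k < n`
(the other values of the index play no role). The function `h k` is the one which
`h₁ = h 1` induces on `U × Y k`; values outside of `U × Y k` play no role. -/
structure ParametricContractionAssumption {X : Type*} [NormedAddCommGroup X] [NormedSpace ℝ X]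
    {Y : ℕ → Type*} [∀ k, NormedAddCommGroup (Y k)] [∀ k, NormedSpace ℝ (Y k)]
    (n : ℕ) (α : ℝ) (U : Set X) (ι : ∀ k, Y (k + 1) →L[ℝ] Y k)
    (h : ∀ k, X × Y k → Y k) : Prop where
  one_le : 1 ≤ n
  alpha_nonneg : 0 ≤ α
  alpha_lt_one : α < 1
  isOpen : IsOpen U
  injective : ∀ k, 1 ≤ k → k < n → Function.Injective (ι k)
  /-- `h_{k+1}` is the restriction of `h_k`. -/
  induced : ∀ k, 1 ≤ k → k < n → ∀ u ∈ U, ∀ y : Y (k + 1),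
    ι k (h (k + 1) (u, y)) = h k (u, ι k y)
  continuousOn : ∀ k, 1 ≤ k → k ≤ n → ContinuousOn (h k) (U ×ˢ univ)
  contraction : ∀ k, 1 ≤ k → k ≤ n → ∀ u ∈ U, ∀ y y' : Y k,
    ‖h k (u, y) - h k (u, y')‖ ≤ α * ‖y - y'‖
  /-- `h_k ∈ 𝒢¹(U × Y_k, Y_k; {0} × Y_k)` -/
  gateaux_snd : ∀ k, 1 ≤ k → k ≤ n →
    IsStronglyGateaux 1 (ContinuousLinearMap.inr ℝ X (Y k)) (U ×ˢ univ) (h k)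
  /-- `h_k ∈ 𝒢ⁿ(U × Y_k, Y_k; X × {0})` -/
  gateaux_fst : ∀ k, 1 ≤ k → k ≤ n →
    IsStronglyGateaux n (ContinuousLinearMap.inl ℝ X (Y k)) (U ×ˢ univ) (h k)
  /-- `h_k ∈ 𝒢ⁿ(U × Y_k, Y_k; X × Y_{k+1})` -/
  gateaux_prod : ∀ k, 1 ≤ k → k < n →
    IsStronglyGateaux n ((ContinuousLinearMap.id ℝ X).prodMap (ι k)) (U ×ˢ univ) (h k)
  /-- Existence of the derivatives with `j` increments in `X` and one in `Y_k`, in any order. -/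
  mixed_exists : ∀ k, 1 ≤ k → k ≤ n → ∀ j, 1 ≤ j → j < n → ∀ σ : Equiv.Perm (Fin (j + 1)),
    ∀ (z : Fin j → X) (z' : Y k),
      IterDirDifferentiableOn (U ×ˢ univ) (List.ofFn (mixedIncrements z z' ∘ σ)) (h k)
  /-- Joint continuity of these derivatives. -/
  mixed_continuous : ∀ k, 1 ≤ k → k ≤ n → ∀ j, 1 ≤ j → j < n → ∀ σ : Equiv.Perm (Fin (j + 1)),
    ContinuousOn
      (fun p : (X × Y k) × ((Fin j → X) × Y k) =>
        iterDirDeriv (List.ofFn (mixedIncrements p.2.1 p.2.2 ∘ σ)) (h k) p.1)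
      ((U ×ˢ univ) ×ˢ univ)

/-- The increments `x₁, …, x_j ∈ X` followed by `y₁, …, y_i ∈ Y_{k+1}`, seen as elements of
`X × Y_k` through the embedding `e : Y_{k+1} → Y_k`. -/
def incrementList {X Z Z' : Type*} [NormedAddCommGroup X] [NormedAddCommGroup Z]
    [NormedSpace ℝ Z] [NormedAddCommGroup Z'] [NormedSpace ℝ Z'] (e : Z' →L[ℝ] Z)
    {j i : ℕ} (x : Fin j → X) (y : Fin i → Z') : List (X × Z) :=
  (List.ofFn fun l => (x l, 0)) ++ List.ofFn fun l => (0, e (y l))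

end

/-!
The sequence `h^{(m)}` and its limit `h` are regarded as one family `H p` with the parameter
`p ∈ ℕ∞`, where `H ⊤ = h`. For continuous functions, uniform convergence on compact sets means joint
continuity on the product with `ℕ∞` (`continuousOn_of_tendstoUniformlyOn`,
`tendstoUniformlyOn_of_continuousOn`). Thus regularity and convergence of the fixed-point maps
are one statement: the fixed-point map of a family of contractions, with a topological space of
parameters, has derivatives which are jointly continuous in the parameter, the base point and the
increments. This is the notion `IsGateauxFamily`. A derivative of such a family is again such a
family, the increment being a further parameter. Hence all arguments on higher derivatives are
inductions on the order that only differentiate once.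

The separate continuity in the definition of `IsStronglyGateaux` improves to joint continuity by
the Banach–Steinhaus theorem (`IsStronglyGateaux.isGateauxFamily`). Derivatives with increments in
`X × Y_{k+1}` are expressed by those with increments first in `X`, then in `Y_{k+1}`, to which the
hypothesis on convergence refers; this uses that iterated derivatives are multilinear and symmetric
(`HasContinuousDirDerivs.eq_sum_incrementList`).

The fixed-point map `φ` with values in `Y_k` is of class `𝒢¹` for every `k`, with
`∂φ = A ∂φ + b`, where `A = ∂_y h_k(u, φ(u))` and `b = ∂_x h_k(u, φ(u))`
(`isGateauxFamily_one_fixed`): if `w` solves this linear equation, then `φ(u) + t w` is a fixed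
point of `h_k(u + t x, ·)` up to `o(t)`. If `φ` is moreover of class `𝒢ʲ` with values in `Y_{k+1}`,
then `b` and `u ↦ A(u) z`, for `z ∈ Y_{k+1}`, are of class `𝒢ʲ` by the chain rule
(`IsGateauxFamily.comp_graph`), and `∂φ` is of class `𝒢ʲ⁻¹` with values in `Y_{k+1}`. The linear
equation then improves `∂φ` to the class `𝒢ʲ` with values in `Y_k`
(`isGateauxFamily_of_linear_equation`), so that `φ` is of class `𝒢ʲ⁺¹` with values in `Y_k`
(`isGateauxFamily_succ_fixed`). The proposition follows by descending induction on `k`, starting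
from the class `𝒢¹` in `Y_n`.
-/

/-! ### Directional derivatives: variable base points, additivity, symmetry -/

section Slope

variable {E₀ E F : Type*} [NormedAddCommGroup E₀] [NormedSpace ℝ E₀]
  [NormedAddCommGroup E] [NormedSpace ℝ E] [NormedAddCommGroup F] [NormedSpace ℝ F]

theorem HasLineDerivAt.hasDerivAt_segment {g : E → F} {c : F} {w z : E} {s t : ℝ}
    (h : HasLineDerivAt ℝ g c (w + s • t • z) z) :
    HasDerivAt (fun s : ℝ => g (w + s • t • z)) (t • c) s := by
  have h7 : HasDerivAt (fun τ : ℝ => (τ - s) * t) t s := by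
    simpa using ((hasDerivAt_id s).sub_const s).mul_const t
  have h8 : HasDerivAt (fun τ : ℝ => g (w + s • t • z + τ • z)) c 0 := h
  have h9 : HasDerivAt (fun τ : ℝ => g (w + s • t • z + τ • z)) c
      ((fun τ : ℝ => (τ - s) * t) s) := by simpa using h8
  refine (HasDerivAt.scomp s h9 h7).congr_of_eventuallyEq (Eventually.of_forall fun τ => ?_)
  simp only [Function.comp]
  congr 1
  simp only [smul_smul, add_assoc, ← add_smul]
  congr 2
  ring

/-- A jointly continuous directional derivative is a strict derivative: in the difference quotient
both the base point and the increment may vary. The reason is the mean value inequality along the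
segment from `z t` to `z t + t • e (ξ t)`. -/
theorem tendsto_slope_of_continuousOn {e : E₀ →L[ℝ] E} {U : Set E} (hU : IsOpen U) {f : E → F}
    {f' : E → E₀ → F} (hd : ∀ u ∈ U, ∀ x, HasLineDerivAt ℝ f (f' u x) u (e x))
    (hc : ContinuousOn (fun q : E × E₀ => f' q.1 q.2) (U ×ˢ univ))
    {z : ℝ → E} {z₀ : E} {ξ : ℝ → E₀} {ξ₀ : E₀} (hz₀ : z₀ ∈ U)
    (hz : Tendsto z (𝓝[≠] 0) (𝓝 z₀)) (hξ : Tendsto ξ (𝓝[≠] 0) (𝓝 ξ₀)) :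
    Tendsto (fun t : ℝ => t⁻¹ • (f (z t + t • e (ξ t)) - f (z t))) (𝓝[≠] 0)
      (𝓝 (f' z₀ ξ₀)) := by
  rw [Metric.tendsto_nhds]
  intro ε hε
  have hc' : Tendsto (fun q : E × E₀ => f' q.1 q.2) (𝓝 (z₀, ξ₀)) (𝓝 (f' z₀ ξ₀)) :=
    hc.continuousAt ((hU.prod isOpen_univ).mem_nhds ⟨hz₀, mem_univ _⟩)
  have h1 : ∀ᶠ q : E × E₀ in 𝓝 (z₀, ξ₀), q.1 ∈ U ∧ dist (f' q.1 q.2) (f' z₀ ξ₀) < ε / 2 :=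
    ((continuous_fst.tendsto (z₀, ξ₀)).eventually (hU.mem_nhds hz₀)).and
      (Metric.tendsto_nhds.1 hc' _ (half_pos hε))
  obtain ⟨δ, hδ, hb⟩ := Metric.eventually_nhds_iff.1 h1
  have ht : Tendsto (fun t : ℝ => t) (𝓝[≠] (0 : ℝ)) (𝓝 0) := tendsto_id.mono_left nhdsWithin_le_nhds
  have hte : Tendsto (fun t : ℝ => t • e (ξ t)) (𝓝[≠] (0 : ℝ)) (𝓝 0) := by
    simpa using ht.smul ((e.continuous.tendsto ξ₀).comp hξ)
  filter_upwards [Metric.tendsto_nhds.1 hz _ (half_pos hδ), Metric.tendsto_nhds.1 hξ _ hδ,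
    Metric.tendsto_nhds.1 hte _ (half_pos hδ), self_mem_nhdsWithin] with t h2 h3 h4 h5
  have ht0 : t ≠ 0 := h5
  set c := f' z₀ ξ₀
  have hseg : ∀ s ∈ Icc (0 : ℝ) 1, z t + s • t • e (ξ t) ∈ U ∧
      dist (f' (z t + s • t • e (ξ t)) (ξ t)) c < ε / 2 := by
    intro s hs
    refine hb (y := (z t + s • t • e (ξ t), ξ t)) ?_
    rw [Prod.dist_eq]
    refine max_lt ?_ h3
    calc dist (z t + s • t • e (ξ t)) z₀ ≤ dist (z t) z₀ + ‖s • t • e (ξ t)‖ := by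
          rw [dist_eq_norm, dist_eq_norm, add_sub_right_comm]; exact norm_add_le _ _
      _ < δ / 2 + δ / 2 := by
          refine add_lt_add h2 (lt_of_le_of_lt ?_ (by simpa using h4))
          rw [norm_smul s]
          refine mul_le_of_le_one_left (norm_nonneg _) ?_
          rw [Real.norm_eq_abs, abs_of_nonneg hs.1]; exact hs.2
      _ = δ := add_halves δ
  have hmv : ‖(fun s : ℝ => f (z t + s • t • e (ξ t)) - s • t • c) 1 -
      (fun s : ℝ => f (z t + s • t • e (ξ t)) - s • t • c) 0‖ ≤ |t| * (ε / 2) := by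
    refine norm_image_sub_le_of_norm_deriv_le_segment_01'
      (f := fun s : ℝ => f (z t + s • t • e (ξ t)) - s • t • c)
      (f' := fun s => t • f' (z t + s • t • e (ξ t)) (ξ t) - t • c) ?_ ?_
    · intro s hs
      have h10 : HasDerivAt (fun s : ℝ => s • t • c) (t • c) s := by
        simpa using (hasDerivAt_id s).smul_const (t • c)
      exact ((hd _ (hseg s hs).1 (ξ t)).hasDerivAt_segment.sub h10).hasDerivWithinAt
    · intro s hs
      rw [← smul_sub, norm_smul, Real.norm_eq_abs]
      refine mul_le_mul_of_nonneg_left ?_ (abs_nonneg t)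
      rw [← dist_eq_norm]
      exact (hseg s ⟨hs.1, hs.2.le⟩).2.le
  have hrew : t⁻¹ • (f (z t + t • e (ξ t)) - f (z t)) - c =
      t⁻¹ • ((fun s : ℝ => f (z t + s • t • e (ξ t)) - s • t • c) 1 -
      (fun s : ℝ => f (z t + s • t • e (ξ t)) - s • t • c) 0) := by
    simp only [one_smul, zero_smul, add_zero, sub_zero]
    rw [sub_right_comm, smul_sub _ _ (t • c), inv_smul_smul₀ ht0]
  rw [dist_eq_norm, hrew, norm_smul, norm_inv, Real.norm_eq_abs]
  have htp : 0 < |t| := abs_pos.2 ht0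
  calc |t|⁻¹ * _ ≤ |t|⁻¹ * (|t| * (ε / 2)) := mul_le_mul_of_nonneg_left hmv (by positivity)
    _ = ε / 2 := by rw [inv_mul_cancel_left₀ htp.ne']
    _ < ε := half_lt_self hε

theorem tendsto_add_smul (u x : E) :
    Tendsto (fun t : ℝ => u + t • x) (𝓝[≠] 0) (𝓝 u) := by
  have : Continuous (fun t : ℝ => u + t • x) := by fun_prop
  simpa using (this.tendsto 0).mono_left nhdsWithin_le_nhds

/-- Directional derivatives are additive in the increment as soon as one of the two is continuous in
the base point. -/
theorem HasLineDerivAt.add_of_continuousOn {U : Set E} (hU : IsOpen U) {f f' : E → F} {x : E}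
    (hd : ∀ u ∈ U, HasLineDerivAt ℝ f (f' u) u x) (hc : ContinuousOn f' U) {u : E} (hu : u ∈ U)
    {v : E} {c : F} (hv : HasLineDerivAt ℝ f c u v) :
    HasLineDerivAt ℝ f (c + f' u) u (v + x) := by
  have h1 := tendsto_slope_of_continuousOn (e := ContinuousLinearMap.toSpanSingleton ℝ x) hU
    (f := f) (f' := fun u s => s • f' u)
    (fun u hu s => by simpa using (hd u hu).smul s)
    (continuousOn_snd.smul (hc.comp continuousOn_fst fun q hq => hq.1)) hu
    (tendsto_add_smul u v) (tendsto_const_nhds (x := (1 : ℝ)))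
  rw [hasLineDerivAt_iff_tendsto_slope_zero] at hv ⊢
  simp only [ContinuousLinearMap.toSpanSingleton_apply, one_smul] at h1
  refine (hv.add h1).congr fun t => ?_
  rw [← smul_add, smul_add t, add_assoc]
  abel_nf

/-- The chain rule for a curve `t ↦ u + t • e (ξ t)`, where `ξ t` converges as `t → 0`. -/
theorem tendsto_slope_comp {e : E₀ →L[ℝ] E} {U : Set E} (hU : IsOpen U)
    {f : E → F} {f' : E → E₀ → F} (hd : ∀ u ∈ U, ∀ x, HasLineDerivAt ℝ f (f' u x) u (e x))
    (hc : ContinuousOn (fun q : E × E₀ => f' q.1 q.2) (U ×ˢ univ)) {u : E} (hu : u ∈ U)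
    {ξ : ℝ → E₀} {x : E₀} (hξ : Tendsto ξ (𝓝[≠] 0) (𝓝 x)) :
    Tendsto (fun t : ℝ => t⁻¹ • (f (u + t • e (ξ t)) - f u)) (𝓝[≠] 0) (𝓝 (f' u x)) :=
  tendsto_slope_of_continuousOn hU hd hc hu tendsto_const_nhds hξ

/-- **Symmetry of second derivatives** for directional derivatives: if `∂_x f`, `∂_y f`,
`∂_y ∂_x f` and `∂_x ∂_y f` exist on an open set and the last two are continuous, then they agree
there. -/
theorem lineDeriv_comm_of_continuousOn {U : Set E} (hU : IsOpen U) {f fx fy fxy fyx : E → F}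
    {x y : E} (hx : ∀ u ∈ U, HasLineDerivAt ℝ f (fx u) u x)
    (hy : ∀ u ∈ U, HasLineDerivAt ℝ f (fy u) u y)
    (hxy : ∀ u ∈ U, HasLineDerivAt ℝ fx (fxy u) u y)
    (hyx : ∀ u ∈ U, HasLineDerivAt ℝ fy (fyx u) u x)
    (hcxy : ContinuousOn fxy U) (hcyx : ContinuousOn fyx U) {u : E} (hu : u ∈ U) :
    fxy u = fyx u := by
  -- The second difference of `f` divided by `t²` tends to either of the mixed derivatives.
  have key : ∀ {x y : E} {fx fxy : E → F}, (∀ u ∈ U, HasLineDerivAt ℝ f (fx u) u x) →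
      (∀ u ∈ U, HasLineDerivAt ℝ fx (fxy u) u y) → ContinuousOn fxy U →
      Tendsto (fun t : ℝ => t⁻¹ • t⁻¹ • (f (u + t • y + t • x) - f (u + t • x) -
        (f (u + t • y) - f u))) (𝓝[≠] 0) (𝓝 (fxy u)) := by
    intro x y fx fxy hx hxy hc
    rw [Metric.tendsto_nhds]
    intro ε hε
    have h1 : ∀ᶠ w in 𝓝 u, w ∈ U ∧ dist (fxy w) (fxy u) < ε / 2 :=
      (hU.eventually_mem hu).and
        (Metric.tendsto_nhds.1 (hc.continuousAt (hU.mem_nhds hu)) _ (half_pos hε))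
    obtain ⟨δ, hδ, hb⟩ := Metric.eventually_nhds_iff.1 h1
    have ht : ∀ z : E, Tendsto (fun t : ℝ => t • z) (𝓝[≠] (0 : ℝ)) (𝓝 0) := fun z => by
      simpa using tendsto_add_smul 0 z
    filter_upwards [Metric.tendsto_nhds.1 (ht x) _ (half_pos hδ),
      Metric.tendsto_nhds.1 (ht y) _ (half_pos hδ), self_mem_nhdsWithin] with t h2 h3 h5
    have ht0 : t ≠ 0 := h5
    set c := fxy u
    have hseg : ∀ r ∈ Icc (0 : ℝ) 1, ∀ s ∈ Icc (0 : ℝ) 1, u + r • t • x + s • t • y ∈ U ∧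
        dist (fxy (u + r • t • x + s • t • y)) c < ε / 2 := by
      have aux : ∀ z : E, dist (t • z) 0 < δ / 2 → ∀ r ∈ Icc (0 : ℝ) 1, ‖r • t • z‖ < δ / 2 := by
        intro z hz r hr
        refine lt_of_le_of_lt ?_ (by simpa using hz)
        rw [norm_smul r]
        refine mul_le_of_le_one_left (norm_nonneg _) ?_
        rw [Real.norm_eq_abs, abs_of_nonneg hr.1]; exact hr.2
      intro r hr s hs
      refine hb ?_
      rw [dist_eq_norm, add_assoc, add_sub_cancel_left]
      calc _ ≤ _ := norm_add_le _ _
        _ < δ / 2 + δ / 2 := add_lt_add (aux x h2 r hr) (aux y h3 s hs)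
        _ = δ := add_halves δ
    have h0 : (0 : ℝ) ∈ Icc (0 : ℝ) 1 := ⟨le_rfl, zero_le_one⟩
    have h1 : (1 : ℝ) ∈ Icc (0 : ℝ) 1 := ⟨zero_le_one, le_rfl⟩
    have hin : ∀ r ∈ Icc (0 : ℝ) 1,
        ‖fx (u + r • t • x + t • y) - fx (u + r • t • x) - t • c‖ ≤ |t| * (ε / 2) := by
      intro r hr
      have := norm_image_sub_le_of_norm_deriv_le_segment_01'
        (f := fun s : ℝ => fx (u + r • t • x + s • t • y) - s • t • c)
        (f' := fun s => t • fxy (u + r • t • x + s • t • y) - t • c) (C := |t| * (ε / 2))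
        (fun s hs => by
          have h10 : HasDerivAt (fun s : ℝ => s • t • c) (t • c) s := by
            simpa using (hasDerivAt_id s).smul_const (t • c)
          exact (HasDerivAt.sub ((hxy _ (hseg r hr s hs).1).hasDerivAt_segment)
            h10).hasDerivWithinAt)
        (fun s hs => by
          rw [← smul_sub, norm_smul, Real.norm_eq_abs, ← dist_eq_norm]
          exact mul_le_mul_of_nonneg_left (hseg r hr s ⟨hs.1, hs.2.le⟩).2.le (abs_nonneg t))
      simp only [one_smul, zero_smul, add_zero, sub_zero] at this
      rwa [sub_right_comm] at this
    have hout := norm_image_sub_le_of_norm_deriv_le_segment_01'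
        (f := fun r : ℝ => f (u + t • y + r • t • x) - f (u + r • t • x) - r • t • t • c)
        (f' := fun r => t • fx (u + t • y + r • t • x) - t • fx (u + r • t • x) - t • t • c)
        (C := |t| * (|t| * (ε / 2)))
        (fun r hr => by
          have h10 : HasDerivAt (fun s : ℝ => s • t • t • c) (t • t • c) r := by
            simpa using (hasDerivAt_id r).smul_const (t • t • c)
          have h11 := (hseg r hr 1 h1).1
          have h12 := (hseg r hr 0 h0).1
          rw [one_smul, add_right_comm] at h11
          rw [zero_smul, add_zero] at h12
          exact ((((hx _ h11).hasDerivAt_segment).sub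
            ((hx _ h12).hasDerivAt_segment)).sub h10).hasDerivWithinAt)
        (fun r hr => by
          have := hin r ⟨hr.1, hr.2.le⟩
          rw [← smul_sub, ← smul_sub, norm_smul, Real.norm_eq_abs, add_right_comm]
          exact mul_le_mul_of_nonneg_left this (abs_nonneg t))
    have hrew : t⁻¹ • t⁻¹ • (f (u + t • y + t • x) - f (u + t • x) - (f (u + t • y) - f u)) - c =
        t⁻¹ • t⁻¹ • ((fun r : ℝ => f (u + t • y + r • t • x) - f (u + r • t • x) -
          r • t • t • c) 1 - (fun r : ℝ => f (u + t • y + r • t • x) - f (u + r • t • x) -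
          r • t • t • c) 0) := by
      simp only [one_smul, zero_smul, add_zero, sub_zero]
      rw [sub_right_comm _ (t • t • c), smul_sub _ _ (t • t • c), inv_smul_smul₀ ht0,
        smul_sub _ _ (t • c), inv_smul_smul₀ ht0]
    rw [dist_eq_norm, hrew, norm_smul, norm_smul, norm_inv, Real.norm_eq_abs]
    have htp : 0 < |t| := abs_pos.2 ht0
    calc |t|⁻¹ * (|t|⁻¹ * _) ≤ |t|⁻¹ * (|t|⁻¹ * (|t| * (|t| * (ε / 2)))) := by gcongr
      _ = ε / 2 := by rw [inv_mul_cancel_left₀ htp.ne', inv_mul_cancel_left₀ htp.ne']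
      _ < ε := half_lt_self hε
  refine tendsto_nhds_unique (key hx hxy hcxy) ((key hy hyx hcyx).congr fun t => ?_)
  rw [add_right_comm]
  abel_nf

end Slope

/-! ### Iterated directional derivatives -/

section IterDirDeriv

variable {E F : Type*} [NormedAddCommGroup E] [NormedSpace ℝ E]
  [NormedAddCommGroup F] [NormedSpace ℝ F] {U : Set E}

theorem Set.EqOn.hasLineDerivAt (hU : IsOpen U) {f g : E → F} (h : EqOn f g U) {u x : E} {c : F}
    (hu : u ∈ U) (hg : HasLineDerivAt ℝ g c u x) : HasLineDerivAt ℝ f c u x :=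
  hg.congr_of_eventuallyEq (h.eventuallyEq_of_mem (hU.mem_nhds hu))

theorem Set.EqOn.lineDeriv (hU : IsOpen U) {f g : E → F} (h : EqOn f g U) (x : E) :
    EqOn (fun u => lineDeriv ℝ f u x) (fun u => lineDeriv ℝ g u x) U := fun _ hu =>
  (h.eventuallyEq_of_mem (hU.mem_nhds hu)).lineDeriv_eq

theorem iterDirDeriv_congr (hU : IsOpen U) :
    ∀ (l : List E) {f g : E → F}, EqOn f g U → EqOn (iterDirDeriv l f) (iterDirDeriv l g) U
  | [], _, _, h => h
  | x :: l, _, _, h => iterDirDeriv_congr hU l (EqOn.lineDeriv hU h x)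

theorem IterDirDifferentiableOn.congr (hU : IsOpen U) :
    ∀ (l : List E) {f g : E → F}, EqOn f g U → IterDirDifferentiableOn U l g →
      IterDirDifferentiableOn U l f
  | [], _, _, _, _ => trivial
  | x :: l, _, _, h, hg =>
    ⟨fun u hu => (hg.1 u hu).congr_of_eventuallyEq (h.eventuallyEq_of_mem (hU.mem_nhds hu)),
      IterDirDifferentiableOn.congr hU l (EqOn.lineDeriv hU h x) hg.2⟩

theorem iterDirDeriv_append : ∀ (l l' : List E) (f : E → F),
    iterDirDeriv (l ++ l') f = iterDirDeriv l' (iterDirDeriv l f)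
  | [], _, _ => rfl
  | x :: l, l', f => iterDirDeriv_append l l' fun u => lineDeriv ℝ f u x

theorem iterDirDifferentiableOn_append : ∀ (l l' : List E) (f : E → F),
    IterDirDifferentiableOn U (l ++ l') f ↔
      IterDirDifferentiableOn U l f ∧ IterDirDifferentiableOn U l' (iterDirDeriv l f)
  | [], _, _ => by simp [IterDirDifferentiableOn, iterDirDeriv]
  | x :: l, l', f => by
    simp only [List.cons_append, IterDirDifferentiableOn, iterDirDeriv,
      iterDirDifferentiableOn_append l l', and_assoc]

theorem HasLineDerivAt.add {f g : E → F} {a b : F} {u x : E} (hf : HasLineDerivAt ℝ f a u x)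
    (hg : HasLineDerivAt ℝ g b u x) : HasLineDerivAt ℝ (fun w => f w + g w) (a + b) u x :=
  HasDerivAt.add hf hg

theorem HasLineDerivAt.const_smul {f : E → F} {a : F} {u x : E} (c : ℝ)
    (hf : HasLineDerivAt ℝ f a u x) : HasLineDerivAt ℝ (fun w => c • f w) (c • a) u x :=
  HasDerivAt.const_smul c hf

theorem iterDirDeriv_add (hU : IsOpen U) : ∀ (l : List E) {f g : E → F},
    IterDirDifferentiableOn U l f → IterDirDifferentiableOn U l g →
    IterDirDifferentiableOn U l (fun u => f u + g u) ∧ EqOn (iterDirDeriv l fun u => f u + g u)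
      (fun u => iterDirDeriv l f u + iterDirDeriv l g u) U
  | [], _, _, _, _ => ⟨trivial, fun _ _ => rfl⟩
  | x :: l, f, g, hf, hg => by
    have h1 : ∀ u ∈ U, HasLineDerivAt ℝ (fun u => f u + g u)
        (lineDeriv ℝ f u x + lineDeriv ℝ g u x) u x := fun u hu =>
      (hf.1 u hu).hasLineDerivAt.add (hg.1 u hu).hasLineDerivAt
    have h2 : EqOn (fun u => lineDeriv ℝ (fun u => f u + g u) u x)
        (fun u => lineDeriv ℝ f u x + lineDeriv ℝ g u x) U := fun u hu => (h1 u hu).lineDeriv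
    have h3 := iterDirDeriv_add hU l hf.2 hg.2
    exact ⟨⟨fun u hu => (h1 u hu).lineDifferentiableAt, h3.1.congr hU l h2⟩,
      (iterDirDeriv_congr hU l h2).trans h3.2⟩

theorem iterDirDeriv_const_smul (hU : IsOpen U) (c : ℝ) : ∀ (l : List E) {f : E → F},
    IterDirDifferentiableOn U l f → EqOn (iterDirDeriv l fun u => c • f u)
      (fun u => c • iterDirDeriv l f u) U
  | [], _, _ => fun _ _ => rfl
  | x :: l, f, hf => by
    have h2 : EqOn (fun u => lineDeriv ℝ (fun u => c • f u) u x)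
        (fun u => c • lineDeriv ℝ f u x) U := fun u hu =>
      ((hf.1 u hu).hasLineDerivAt.const_smul c).lineDeriv
    exact (iterDirDeriv_congr hU l h2).trans (iterDirDeriv_const_smul hU c l hf.2)

end IterDirDeriv

/-! ### Multilinearity, symmetry and joint continuity of the Gâteaux differentials -/

section Pointwise

variable {E₀ E F : Type*} [NormedAddCommGroup E₀] [NormedSpace ℝ E₀]
  [NormedAddCommGroup E] [NormedSpace ℝ E] [NormedAddCommGroup F] [NormedSpace ℝ F]
  {e : E₀ →L[ℝ] E} {U : Set E} {f : E → F} {n : ℕ}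

/-- The iterated directional derivatives of `f` up to order `n` with increments in `E₀` exist on
`U`, and each of them is continuous on `U`, for fixed increments. -/
def HasContinuousDirDerivs (n : ℕ) (e : E₀ →L[ℝ] E) (U : Set E) (f : E → F) : Prop :=
  ∀ l : List E₀, l.length ≤ n →
    IterDirDifferentiableOn U (l.map e) f ∧ ContinuousOn (iterDirDeriv (l.map e) f) U

namespace HasContinuousDirDerivs

theorem mono {m : ℕ} (h : HasContinuousDirDerivs n e U f) (hm : m ≤ n) :
    HasContinuousDirDerivs m e U f := fun l hl => h l (hl.trans hm)

theorem hasLineDerivAt (h : HasContinuousDirDerivs (n + 1) e U f) {u : E} (hu : u ∈ U) (x : E₀) :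
    HasLineDerivAt ℝ f (lineDeriv ℝ f u (e x)) u (e x) :=
  ((h [x] (by simp)).1.1 u hu).hasLineDerivAt

theorem continuousOn_lineDeriv (h : HasContinuousDirDerivs (n + 1) e U f) (x : E₀) :
    ContinuousOn (fun u => lineDeriv ℝ f u (e x)) U :=
  (h [x] (by simp)).2

theorem lineDeriv (h : HasContinuousDirDerivs (n + 1) e U f) (x : E₀) :
    HasContinuousDirDerivs n e U fun u => lineDeriv ℝ f u (e x) := fun l hl =>
  ⟨(h (x :: l) (by simpa using hl)).1.2, (h (x :: l) (by simpa using hl)).2⟩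

theorem iterate {m : ℕ} : ∀ (l : List E₀) {f : E → F},
    HasContinuousDirDerivs (l.length + m) e U f →
      HasContinuousDirDerivs m e U (iterDirDeriv (l.map e) f)
  | [], _, h => h.mono (by simp)
  | x :: l, _, h => iterate l ((h.mono (by simp [add_right_comm])).lineDeriv x)

theorem lineDeriv_add (h : HasContinuousDirDerivs (n + 1) e U f) (hU : IsOpen U) {u : E}
    (hu : u ∈ U) (x y : E₀) :
    _root_.lineDeriv ℝ f u (e (x + y)) =
      _root_.lineDeriv ℝ f u (e x) + _root_.lineDeriv ℝ f u (e y) := by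
  rw [map_add]
  exact (HasLineDerivAt.add_of_continuousOn hU (fun u hu => h.hasLineDerivAt hu y)
    (h.continuousOn_lineDeriv y) hu (h.hasLineDerivAt hu x)).lineDeriv

/-- Iterated directional derivatives do not depend on the order of the increments. -/
theorem iterDirDeriv_perm (hU : IsOpen U) {l l' : List E₀} (hl : l.Perm l') :
    ∀ {f : E → F}, HasContinuousDirDerivs l.length e U f →
      EqOn (iterDirDeriv (l.map e) f) (iterDirDeriv (l'.map e) f) U := by
  induction hl with
  | nil => exact fun _ _ _ => rfl
  | cons x _ ih => exact fun h => ih (h.lineDeriv x)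
  | swap x y l =>
    intro f h
    refine iterDirDeriv_congr hU (l.map e) fun u hu => ?_
    have h' : HasContinuousDirDerivs (0 + 1 + 1) e U f := h.mono (by simp)
    exact lineDeriv_comm_of_continuousOn hU (fun u hu => h'.hasLineDerivAt hu y)
      (fun u hu => h'.hasLineDerivAt hu x) (fun u hu => (h'.lineDeriv y).hasLineDerivAt hu x)
      (fun u hu => (h'.lineDeriv x).hasLineDerivAt hu y) ((h'.lineDeriv y).continuousOn_lineDeriv x)
      ((h'.lineDeriv x).continuousOn_lineDeriv y) hu
  | trans h₁ _ ih₁ ih₂ => exact fun h => (ih₁ h).trans (ih₂ (h₁.length_eq ▸ h))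

theorem iterDirDeriv_add_slot (hU : IsOpen U) (l₁ l₂ : List E₀) (x y : E₀)
    (h : HasContinuousDirDerivs (l₁.length + (l₂.length + 1)) e U f) {u : E} (hu : u ∈ U) :
    iterDirDeriv ((l₁ ++ (x + y) :: l₂).map e) f u =
      iterDirDeriv ((l₁ ++ x :: l₂).map e) f u +
        iterDirDeriv ((l₁ ++ y :: l₂).map e) f u := by
  have hg := HasContinuousDirDerivs.iterate l₁ h
  simp only [List.map_append, iterDirDeriv_append, List.map_cons, iterDirDeriv]
  rw [iterDirDeriv_congr hU (l₂.map e) (fun w hw => hg.lineDeriv_add hU hw x y) hu]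
  exact (iterDirDeriv_add hU (l₂.map e) ((hg.lineDeriv x) l₂ le_rfl).1
    ((hg.lineDeriv y) l₂ le_rfl).1).2 hu

theorem iterDirDeriv_smul_slot (hU : IsOpen U) (l₁ l₂ : List E₀) (c : ℝ) (x : E₀)
    (h : HasContinuousDirDerivs (l₁.length + (l₂.length + 1)) e U f) {u : E} (hu : u ∈ U) :
    iterDirDeriv ((l₁ ++ (c • x) :: l₂).map e) f u =
      c • iterDirDeriv ((l₁ ++ x :: l₂).map e) f u := by
  have hg := HasContinuousDirDerivs.iterate l₁ h
  simp only [List.map_append, iterDirDeriv_append, List.map_cons, iterDirDeriv, map_smul,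
    lineDeriv_smul]
  exact iterDirDeriv_const_smul hU c (l₂.map e) ((hg.lineDeriv x) l₂ le_rfl).1 hu

end HasContinuousDirDerivs

theorem List.ofFn_update_eq_append {A : Type*} {j : ℕ} [DecidableEq (Fin j)] (v : Fin j → A)
    (i : Fin j) (x : A) : List.ofFn (Function.update v i x) =
      (List.ofFn v).take i ++ x :: (List.ofFn v).drop (i + 1) := by
  have : List.ofFn (Function.update v i x) = (List.ofFn v).set i x := by
    refine List.ext_getElem (by simp) fun k h1 h2 => ?_
    have hk : k < j := by simpa using h1
    simp only [List.getElem_ofFn, List.getElem_set, Function.update_apply, Fin.ext_iff, eq_comm]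
  rw [this, List.set_eq_take_append_cons_drop, if_pos (by simp)]

/-- The `j`-th Gâteaux differential at a point, as a multilinear map on `E₀ʲ`. -/
noncomputable def HasContinuousDirDerivs.multilinear (h : HasContinuousDirDerivs n e U f) (hU : IsOpen U)
    {j : ℕ} (hj : j ≤ n) {u : E} (hu : u ∈ U) : MultilinearMap ℝ (fun _ : Fin j => E₀) F where
  toFun v := iterDirDeriv (List.ofFn fun i => e (v i)) f u
  map_update_add' v i x y := by
    have := HasContinuousDirDerivs.iterDirDeriv_add_slot hU ((List.ofFn v).take i)
      ((List.ofFn v).drop (i + 1)) x y (h.mono (by simp; omega)) hu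
    simpa only [← List.ofFn_update_eq_append, List.map_ofFn, Function.comp_def] using this
  map_update_smul' v i c x := by
    have := HasContinuousDirDerivs.iterDirDeriv_smul_slot hU ((List.ofFn v).take i)
      ((List.ofFn v).drop (i + 1)) c x (h.mono (by simp; omega)) hu
    simpa only [← List.ofFn_update_eq_append, List.map_ofFn, Function.comp_def] using this

/-- The Gâteaux differentials in the definition of `IsStronglyGateaux` are the iterated directional
derivatives. -/
theorem iterDirDeriv_eq_of_hasLineDerivAt (hU : IsOpen U)
    {D : (j : ℕ) → E → MultilinearMap ℝ (fun _ : Fin j => E₀) F}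
    (h0 : ∀ u ∈ U, ∀ v : Fin 0 → E₀, D 0 u v = f u)
    (hD : ∀ j < n, ∀ u ∈ U, ∀ (v : Fin j → E₀) (x : E₀),
      HasLineDerivAt ℝ (fun w => D j w v) (D (j + 1) u (Fin.snoc v x)) u (e x)) :
    ∀ j ≤ n, ∀ v : Fin j → E₀, IterDirDifferentiableOn U (List.ofFn fun i => e (v i)) f ∧
      EqOn (iterDirDeriv (List.ofFn fun i => e (v i)) f) (fun u => D j u v) U
  | 0, _, v => by
    simp only [List.ofFn_zero]
    exact ⟨trivial, fun u hu => (h0 u hu v).symm⟩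
  | j + 1, hj, v => by
    obtain ⟨h1, h2⟩ := iterDirDeriv_eq_of_hasLineDerivAt hU h0 hD j (by omega) (Fin.init v)
    have h3 : ∀ u ∈ U, HasLineDerivAt ℝ (iterDirDeriv (List.ofFn fun i => e (Fin.init v i)) f)
        (D (j + 1) u v) u (e (v (Fin.last j))) := fun u hu => by
      have := hD j (by omega) u hu (Fin.init v) (v (Fin.last j))
      rw [Fin.snoc_init_self] at this
      exact h2.hasLineDerivAt hU hu this
    rw [List.ofFn_succ_last]
    exact ⟨(iterDirDifferentiableOn_append _ _ _).2
      ⟨h1, fun u hu => (h3 u hu).lineDifferentiableAt, trivial⟩, fun u hu => by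
        rw [iterDirDeriv_append]; exact (h3 u hu).lineDeriv⟩

theorem IsStronglyGateaux.hasContinuousDirDerivs (hU : IsOpen U)
    (h : IsStronglyGateaux n e U f) : HasContinuousDirDerivs n e U f := by
  obtain ⟨D, h0, -, hc, hD⟩ := h
  intro l hl
  have h1 := iterDirDeriv_eq_of_hasLineDerivAt hU h0 hD l.length hl l.get
  have h2 : (List.ofFn fun i => e (l.get i)) = l.map e := by
    conv_rhs => rw [← List.ofFn_get l, List.map_ofFn]
    rfl
  rw [h2] at h1
  exact ⟨h1.1, (hc _ hl _).congr h1.2⟩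

/-- A consequence of the Banach–Steinhaus theorem: a family of continuous linear maps which depends
continuously on a parameter in the strong topology is jointly continuous. -/
theorem continuousOn_of_linear [CompleteSpace E₀] {Q : Type*} [TopologicalSpace Q]
    [FirstCountableTopology Q] {S : Set Q} {B : Q → E₀ →ₗ[ℝ] F}
    (hB : ∀ q ∈ S, Continuous (B q)) (hc : ∀ x, ContinuousOn (fun q => B q x) S) :
    ContinuousOn (fun p : Q × E₀ => B p.1 p.2) (S ×ˢ univ) := by
  classical
  rintro ⟨q₀, x₀⟩ ⟨hq₀, -⟩
  refine tendsto_of_seq_tendsto fun s hs => ?_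
  rw [tendsto_nhdsWithin_iff] at hs
  obtain ⟨hs, hS⟩ := hs
  have hq : Tendsto (fun i => (s i).1) atTop (𝓝[S] q₀) :=
    tendsto_nhdsWithin_iff.2 ⟨(continuous_fst.tendsto _).comp hs, hS.mono fun i hi => hi.1⟩
  have hx : Tendsto (fun i => (s i).2) atTop (𝓝 x₀) := (continuous_snd.tendsto _).comp hs
  let L : ℕ → E₀ →L[ℝ] F := fun i => if h : (s i).1 ∈ S then ⟨B (s i).1, hB _ h⟩ else 0
  have hL : ∀ x, ∀ᶠ i in atTop, L i x = B (s i).1 x := fun x => by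
    filter_upwards [hS] with i hi
    simp only [L, dif_pos hi.1]
    rfl
  have hlim : ∀ x, Tendsto (fun i => L i x) atTop (𝓝 (B q₀ x)) := fun x =>
    ((hc x q₀ hq₀).tendsto.comp hq).congr' ((hL x).mono fun i hi => hi.symm)
  obtain ⟨C, hC⟩ := banach_steinhaus (g := L) fun x => by
    obtain ⟨C, hC⟩ := (Metric.isBounded_range_of_tendsto _ (hlim x)).exists_norm_le
    exact ⟨C, fun i => hC _ (mem_range_self i)⟩
  have h1 : Tendsto (fun i => L i ((s i).2 - x₀)) atTop (𝓝 0) := by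
    refine squeeze_zero_norm (fun i => (L i).le_of_opNorm_le (hC i) _) ?_
    have : Tendsto (fun i => ‖(s i).2 - x₀‖) atTop (𝓝 0) := by
      simpa using (hx.sub_const x₀).norm
    simpa using this.const_mul C
  have h2 := h1.add (hlim x₀)
  rw [zero_add] at h2
  refine h2.congr' ?_
  filter_upwards [hS] with i hi
  simp only [L, dif_pos hi.1, ← map_add, sub_add_cancel]
  rfl

/-- The multilinear version of `continuousOn_of_linear`, by induction on the number of slots. -/
theorem continuousOn_of_multilinear [CompleteSpace E₀] {Q : Type*} [TopologicalSpace Q]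
    [FirstCountableTopology Q] {S : Set Q} : ∀ {j : ℕ}
    {D : Q → MultilinearMap ℝ (fun _ : Fin j => E₀) F},
    (∀ q ∈ S, ∀ (v : Fin j → E₀) (i : Fin j), Continuous fun x => D q (Function.update v i x)) →
    (∀ v : Fin j → E₀, ContinuousOn (fun q => D q v) S) →
    ContinuousOn (fun p : Q × (Fin j → E₀) => D p.1 p.2) (S ×ˢ univ)
  | 0, D, _, hv => by
    refine ((hv 0).comp continuousOn_fst fun p hp => hp.1).congr fun p _ => ?_
    simp only [Function.comp, Subsingleton.elim p.2 0]
  | j + 1, D, hs, hv => by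
    have ih : ∀ x : E₀, ContinuousOn (fun p : Q × (Fin j → E₀) =>
        D p.1 (Fin.cons x p.2)) (S ×ˢ univ) := fun x =>
      continuousOn_of_multilinear (D := fun q => (D q).curryLeft x)
        (fun q hq v i => by
          refine (hs q hq (Fin.cons x v) i.succ).congr fun y => ?_
          rw [MultilinearMap.curryLeft_apply]
          congr 1
          exact (Fin.cons_update ..).symm)
        (fun v => hv (Fin.cons x v))
    have hcons : ∀ (q : Q) (v : Fin j → E₀) (x : E₀),
        (D q).toLinearMap (Fin.cons 0 v) 0 x = D q (Fin.cons x v) := fun q v x => by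
      rw [MultilinearMap.toLinearMap_apply]
      congr 1
      exact Fin.update_cons_zero (α := fun _ => E₀) 0 v x
    have h := continuousOn_of_linear (S := S ×ˢ (univ : Set (Fin j → E₀)))
      (B := fun p : Q × (Fin j → E₀) => (D p.1).toLinearMap (Fin.cons 0 p.2) 0)
      (fun p hp => hs p.1 hp.1 (Fin.cons 0 p.2) 0)
      (fun x => (ih x).congr fun p _ => hcons p.1 p.2 x)
    have h2 : ContinuousOn (fun p : Q × (Fin (j + 1) → E₀) => ((p.1, Fin.tail p.2), p.2 0))
        (S ×ˢ univ) := by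
      refine Continuous.continuousOn ?_
      refine (continuous_fst.prodMk ?_).prodMk ((continuous_apply 0).comp continuous_snd)
      exact continuous_pi fun i => (continuous_apply i.succ).comp continuous_snd
    refine (h.comp h2 fun p hp => ⟨⟨hp.1, mem_univ _⟩, mem_univ _⟩).congr fun p _ => ?_
    simp only [Function.comp]
    rw [hcons, Fin.cons_self_tail]

end Pointwise

/-! ### Families of strongly Gâteaux differentiable functions -/

section Family

variable {P Q E₀ E F : Type*} [TopologicalSpace P] [TopologicalSpace Q]
  [NormedAddCommGroup E₀] [NormedSpace ℝ E₀]
  [NormedAddCommGroup E] [NormedSpace ℝ E] [NormedAddCommGroup F] [NormedSpace ℝ F]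
  {e : E₀ →L[ℝ] E} {U : Set E} {f g : P → E → F} {n : ℕ}

/-- A family `f p`, `p ∈ P`, of functions on `U ⊆ E` is of class `𝒢ⁿ` with respect to `E₀`, jointly
with the parameter: the directional derivatives up to order `n` with increments in `E₀` exist, and
they are jointly continuous in the parameter, the base point and the increments. -/
def IsGateauxFamily (n : ℕ) (e : E₀ →L[ℝ] E) (U : Set E) (f : P → E → F) : Prop :=
  ∀ j ≤ n, (∀ p (v : Fin j → E₀), IterDirDifferentiableOn U (List.ofFn fun i => e (v i)) (f p)) ∧
    ContinuousOn (fun q : (P × E) × (Fin j → E₀) =>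
      iterDirDeriv (List.ofFn fun i => e (q.2 i)) (f q.1.1) q.1.2) ((univ ×ˢ U) ×ˢ univ)

namespace IsGateauxFamily

theorem mono {m : ℕ} (h : IsGateauxFamily n e U f) (hm : m ≤ n) : IsGateauxFamily m e U f :=
  fun j hj => h j (hj.trans hm)

theorem comp_param (h : IsGateauxFamily n e U f) {r : Q → P} (hr : Continuous r) :
    IsGateauxFamily n e U fun q => f (r q) := fun j hj =>
  ⟨fun q v => (h j hj).1 (r q) v, (h j hj).2.comp
    (f := fun q : (Q × E) × (Fin j → E₀) => ((r q.1.1, q.1.2), q.2)) (by fun_prop)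
    fun q hq => ⟨⟨mem_univ _, hq.1.2⟩, mem_univ _⟩⟩

theorem congr (hU : IsOpen U) (h : IsGateauxFamily n e U f) (hg : ∀ p, EqOn (g p) (f p) U) :
    IsGateauxFamily n e U g := fun j hj =>
  ⟨fun p v => ((h j hj).1 p v).congr hU _ (hg p), (h j hj).2.congr fun q hq =>
    iterDirDeriv_congr hU _ (hg q.1.1) hq.1.2⟩

theorem add (hU : IsOpen U) (hf : IsGateauxFamily n e U f) (hg : IsGateauxFamily n e U g) :
    IsGateauxFamily n e U fun p u => f p u + g p u := fun j hj =>
  ⟨fun p v => (iterDirDeriv_add hU _ ((hf j hj).1 p v) ((hg j hj).1 p v)).1,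
    ((hf j hj).2.add (hg j hj).2).congr fun q hq =>
      (iterDirDeriv_add hU _ ((hf j hj).1 q.1.1 q.2) ((hg j hj).1 q.1.1 q.2)).2 hq.1.2⟩

theorem continuousOn (h : IsGateauxFamily n e U f) :
    ContinuousOn (fun q : P × E => f q.1 q.2) (univ ×ˢ U) := by
  have := (h 0 (Nat.zero_le _)).2.comp (s := univ ×ˢ U)
    (f := fun q : P × E => (q, (0 : Fin 0 → E₀))) (by fun_prop) fun q hq => ⟨hq, mem_univ _⟩
  simpa [Function.comp_def, iterDirDeriv] using this

theorem zero_iff : IsGateauxFamily 0 e U f ↔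
    ContinuousOn (fun q : P × E => f q.1 q.2) (univ ×ˢ U) := by
  refine ⟨fun h => h.continuousOn, fun h j hj => ?_⟩
  obtain rfl : j = 0 := by omega
  simp only [List.ofFn_zero, iterDirDeriv, IterDirDifferentiableOn, implies_true, true_and]
  exact h.comp continuousOn_fst fun q hq => hq.1

theorem hasLineDerivAt (h : IsGateauxFamily (n + 1) e U f) (p : P) {u : E} (hu : u ∈ U) (x : E₀) :
    HasLineDerivAt ℝ (f p) (lineDeriv ℝ (f p) u (e x)) u (e x) := by
  have := (h 1 (by omega)).1 p fun _ => x
  simp only [List.ofFn_succ, List.ofFn_zero, IterDirDifferentiableOn] at this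
  exact (this.1 u hu).hasLineDerivAt

theorem lineDeriv (h : IsGateauxFamily (n + 1) e U f) :
    IsGateauxFamily n e U fun (q : P × E₀) u => lineDeriv ℝ (f q.1) u (e q.2) := by
  intro j hj
  have h1 := h (j + 1) (by omega)
  constructor
  · rintro ⟨p, x⟩ v
    have := h1.1 p (Fin.cons x v)
    simp only [List.ofFn_succ, Fin.cons_zero, Fin.cons_succ] at this
    exact this.2
  · have := h1.2.comp (s := (univ ×ˢ U) ×ˢ univ)
      (f := fun q : ((P × E₀) × E) × (Fin j → E₀) =>
        ((q.1.1.1, q.1.2), (Fin.cons q.1.1.2 q.2 : Fin (j + 1) → E₀)))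
      (by
        refine Continuous.continuousOn (Continuous.prodMk (by fun_prop) ?_)
        refine continuous_pi fun i => ?_
        cases i using Fin.cases with
        | zero => simp only [Fin.cons_zero]; fun_prop
        | succ i => simp only [Fin.cons_succ]; fun_prop)
      fun q hq => ⟨⟨mem_univ _, hq.1.2⟩, mem_univ _⟩
    simpa only [Function.comp_def, List.ofFn_succ, Fin.cons_zero, Fin.cons_succ,
      iterDirDeriv] using this

theorem of_hasLineDerivAt (hU : IsOpen U)
    (hf : ContinuousOn (fun q : P × E => f q.1 q.2) (univ ×ˢ U)) {f' : P × E₀ → E → F}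
    (hd : ∀ p, ∀ u ∈ U, ∀ x, HasLineDerivAt ℝ (f p) (f' (p, x) u) u (e x))
    (hf' : IsGateauxFamily n e U f') : IsGateauxFamily (n + 1) e U f := by
  intro j hj
  cases j with
  | zero => exact zero_iff.2 hf 0 le_rfl
  | succ j =>
    have h1 := hf' j (by omega)
    have h2 : ∀ p x, EqOn (fun u => _root_.lineDeriv ℝ (f p) u (e x)) (f' (p, x)) U :=
      fun p x u hu => (hd p u hu x).lineDeriv
    simp only [List.ofFn_succ, iterDirDeriv, IterDirDifferentiableOn]
    refine ⟨fun p v => ⟨fun u hu => (hd p u hu _).lineDifferentiableAt,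
      (h1.1 (p, v 0) fun i => v i.succ).congr hU _ (h2 p (v 0))⟩, ?_⟩
    refine (h1.2.comp (f := fun q : (P × E) × (Fin (j + 1) → E₀) =>
      (((q.1.1, q.2 0), q.1.2), fun i : Fin j => q.2 i.succ)) (by fun_prop)
      fun q hq => ⟨⟨mem_univ _, hq.1.2⟩, mem_univ _⟩).congr fun q hq => ?_
    exact iterDirDeriv_congr hU _ (h2 q.1.1 (q.2 0)) hq.1.2

theorem hasContinuousDirDerivs (h : IsGateauxFamily n e U f) (p : P) :
    HasContinuousDirDerivs n e U (f p) := by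
  intro l hl
  have h1 := h l.length hl
  have h2 : (List.ofFn fun i => e (l.get i)) = l.map e := by
    conv_rhs => rw [← List.ofFn_get l, List.map_ofFn]
    rfl
  rw [← h2]
  exact ⟨h1.1 p l.get, h1.2.comp (f := fun u => ((p, u), l.get)) (by fun_prop)
    fun u hu => ⟨⟨mem_univ _, hu⟩, mem_univ _⟩⟩

theorem isStronglyGateaux (hU : IsOpen U) (h : IsGateauxFamily n e U f) (p : P) :
    IsStronglyGateaux n e U (f p) := by
  classical
  have h' := h.hasContinuousDirDerivs p
  have hD : ∀ {j : ℕ} (hj : j ≤ n) {u : E} (hu : u ∈ U) (v : Fin j → E₀),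
      (if hh : j ≤ n ∧ u ∈ U then h'.multilinear hU hh.1 hh.2 else 0) v =
        iterDirDeriv (List.ofFn fun i => e (v i)) (f p) u := fun hj u hu v => by
    rw [dif_pos ⟨hj, hu⟩]; rfl
  have hcont : ∀ {j : ℕ} (hj : j ≤ n), ContinuousOn (fun q : E × (Fin j → E₀) =>
      iterDirDeriv (List.ofFn fun i => e (q.2 i)) (f p) q.1) (U ×ˢ univ) := fun hj =>
    (h _ hj).2.comp (f := fun q : E × (Fin _ → E₀) => ((p, q.1), q.2)) (by fun_prop)
      fun q hq => ⟨⟨mem_univ _, hq.1⟩, mem_univ _⟩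
  refine ⟨fun j u => if hh : j ≤ n ∧ u ∈ U then h'.multilinear hU hh.1 hh.2 else 0,
    fun u hu v => ?_, fun j hj u hu v i => ?_, fun j hj v => ?_, fun j hj u hu v x => ?_⟩
  · rw [hD (Nat.zero_le n) hu, List.ofFn_zero]; rfl
  · simp only [hD hj hu]
    exact continuousOn_univ.1 ((hcont hj).comp (f := fun x => (u, Function.update v i x))
      (Continuous.continuousOn (by fun_prop)) fun x _ => ⟨hu, mem_univ _⟩)
  · exact ((hcont hj).comp (f := fun u => (u, v)) (by fun_prop)
      fun u hu => ⟨hu, mem_univ _⟩).congr fun u hu => hD hj hu v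
  · rw [hD hj hu, List.ofFn_succ_last, iterDirDeriv_append]
    simp only [Fin.snoc_castSucc, Fin.snoc_last, iterDirDeriv]
    have h1 := (h (j + 1) hj).1 p (Fin.snoc v x)
    rw [List.ofFn_succ_last, iterDirDifferentiableOn_append] at h1
    simp only [Fin.snoc_castSucc, Fin.snoc_last, IterDirDifferentiableOn] at h1
    exact Set.EqOn.hasLineDerivAt hU (fun w hw => hD hj.le hw v) hu
      (h1.2.1 u hu).hasLineDerivAt

end IsGateauxFamily

/-- On a complete space of increments, the separate continuity in the definition of
`IsStronglyGateaux` improves to joint continuity. -/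
theorem IsStronglyGateaux.isGateauxFamily [CompleteSpace E₀] (hU : IsOpen U) {f : E → F}
    (h : IsStronglyGateaux n e U f) : IsGateauxFamily n e U fun _ : Unit => f := by
  obtain ⟨D, h0, hs, hc, hD⟩ := h
  intro j hj
  have h1 := iterDirDeriv_eq_of_hasLineDerivAt hU h0 hD j hj
  refine ⟨fun _ v => (h1 v).1, ?_⟩
  have h2 := continuousOn_of_multilinear (hs j hj) (hc j hj)
  exact (h2.comp (f := fun q : (Unit × E) × (Fin j → E₀) => (q.1.2, q.2)) (by fun_prop)
    fun q hq => ⟨hq.1.2, mem_univ _⟩).congr fun q hq => (h1 q.2).2 hq.1.2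

end Family

/-! ### Product rule and chain rule -/

section Rules

-- The inductions replace the space `P` of parameters by `P × X`, so that its universe has to contain
-- the one of the increments.

universe w uX uZ uE uF

/-- The product rule for a family `B (p, z)` which is linear in the parameter `z`: substituting for
`z` a function of class `𝒢ⁿ` gives a function of class `𝒢ⁿ`. -/
theorem IsGateauxFamily.comp_linear_param {E₀ : Type uX} {E : Type uE} {Z : Type uZ} {F : Type uF}
    [NormedAddCommGroup E₀] [NormedSpace ℝ E₀] [NormedAddCommGroup E] [NormedSpace ℝ E]
    [NormedAddCommGroup Z] [NormedSpace ℝ Z] [NormedAddCommGroup F] [NormedSpace ℝ F]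
    {e : E₀ →L[ℝ] E} {U : Set E} (hU : IsOpen U) {n : ℕ} :
    ∀ {P : Type (max w uX)} [TopologicalSpace P] {B : P × Z → E → F} {v : P → E → Z},
      IsGateauxFamily n e U B → (∀ p, ∀ u ∈ U, IsLinearMap ℝ fun z => B (p, z) u) →
      IsGateauxFamily n e U v → IsGateauxFamily n e U fun p u => B (p, v p u) u := by
  induction n with
  | zero =>
    intro P _ B v hB _ hv
    rw [zero_iff] at hB hv ⊢
    exact hB.comp (f := fun q : P × E => ((q.1, v q.1 q.2), q.2))
      ((continuousOn_fst.prodMk hv).prodMk continuousOn_snd) fun q hq => ⟨mem_univ _, hq.2⟩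
  | succ n ih =>
    intro P _ B v hB hl hv
    have hcB := hB.continuousOn
    refine of_hasLineDerivAt hU ?_ (f' := fun q u =>
      _root_.lineDeriv ℝ (B (q.1, v q.1 u)) u (e q.2) +
        B (q.1, _root_.lineDeriv ℝ (v q.1) u (e q.2)) u) ?_ ?_
    · exact hcB.comp (f := fun q : P × E => ((q.1, v q.1 q.2), q.2))
        ((continuousOn_fst.prodMk hv.continuousOn).prodMk continuousOn_snd)
        fun q hq => ⟨mem_univ _, hq.2⟩
    · intro p u hu x
      have h1 := hB.hasLineDerivAt (p, v p u) hu x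
      have h2 := hv.hasLineDerivAt p hu x
      rw [hasLineDerivAt_iff_tendsto_slope_zero] at h1 h2 ⊢
      have h3 : ContinuousAt (fun q : (P × Z) × E => B q.1 q.2)
          ((p, _root_.lineDeriv ℝ (v p) u (e x)), u) :=
        hcB.continuousAt ((isOpen_univ.prod hU).mem_nhds ⟨mem_univ _, hu⟩)
      have h4 := h3.tendsto.comp ((tendsto_const_nhds (x := p) (f := 𝓝[≠] (0 : ℝ))
        |>.prodMk_nhds h2).prodMk_nhds (tendsto_add_smul u (e x)))
      refine (h1.add h4).congr' ?_
      filter_upwards [(tendsto_add_smul u (e x)).eventually (hU.eventually_mem hu)] with t ht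
      have hlt := hl p _ ht
      simp only [Function.comp]
      rw [hlt.map_smul, hlt.map_sub, ← smul_add]
      congr 1
      abel
    · refine add hU ?_ ?_
      · exact ih (P := P × E₀)
          (B := fun q u => _root_.lineDeriv ℝ (B (q.1.1, q.2)) u (e q.1.2))
          (v := fun q u => v q.1 u)
          (hB.lineDeriv.comp_param (r := fun q : (P × E₀) × Z => ((q.1.1, q.2), q.1.2))
            (by fun_prop))
          (fun p u hu => by
            constructor
            · intro z z'
              refine HasLineDerivAt.lineDeriv (Set.EqOn.hasLineDerivAt hU
                (fun w hw => (hl p.1 w hw).map_add z z') hu ?_)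
              exact (hB.hasLineDerivAt _ hu _).add (hB.hasLineDerivAt _ hu _)
            · intro c z
              refine HasLineDerivAt.lineDeriv (Set.EqOn.hasLineDerivAt hU
                (fun w hw => (hl p.1 w hw).map_smul c z) hu ?_)
              exact (hB.hasLineDerivAt _ hu _).const_smul c)
          ((hv.mono n.le_succ).comp_param continuous_fst)
      · exact ih (P := P × E₀) (B := fun q u => B (q.1.1, q.2) u)
          (v := fun q u => _root_.lineDeriv ℝ (v q.1) u (e q.2))
          ((hB.mono n.le_succ).comp_param (r := fun q : (P × E₀) × Z => (q.1.1, q.2))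
            (by fun_prop))
          (fun p u hu => hl p.1 u hu) hv.lineDeriv

/-- In a family of class `𝒢¹`, the directional derivative is linear in the increment. -/
theorem IsGateauxFamily.isLinearMap_lineDeriv {P E₀ E F : Type*} [TopologicalSpace P]
    [NormedAddCommGroup E₀] [NormedSpace ℝ E₀] [NormedAddCommGroup E] [NormedSpace ℝ E]
    [NormedAddCommGroup F] [NormedSpace ℝ F] {e : E₀ →L[ℝ] E} {U : Set E} {f : P → E → F} {n : ℕ}
    (hU : IsOpen U) (h : IsGateauxFamily (n + 1) e U f) (p : P) {u : E} (hu : u ∈ U) :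
    IsLinearMap ℝ fun x => _root_.lineDeriv ℝ (f p) u (e x) where
  map_add x y := (h.hasContinuousDirDerivs p).lineDeriv_add hU hu x y
  map_smul c x := by rw [map_smul, lineDeriv_smul]

/-- The chain rule: if `G p` is of class `𝒢ⁿ` on `U × Y` for increments in `X × Z`, and `φ p` is of
class `𝒢ⁿ` as a map to the smaller space `Z`, then `u ↦ G p (u, φ p u)` is of class `𝒢ⁿ`. -/
theorem IsGateauxFamily.comp_graph {X : Type uX} {Z : Type uZ} {Y : Type uE} {F : Type uF}
    [NormedAddCommGroup X] [NormedSpace ℝ X] [NormedAddCommGroup Z] [NormedSpace ℝ Z]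
    [NormedAddCommGroup Y] [NormedSpace ℝ Y] [NormedAddCommGroup F] [NormedSpace ℝ F]
    {i : Z →L[ℝ] Y} {U : Set X} (hU : IsOpen U) {n : ℕ} :
    ∀ {P : Type (max w uX uZ)} [TopologicalSpace P] {G : P → X × Y → F} {φ : P → X → Z},
      IsGateauxFamily n ((ContinuousLinearMap.id ℝ X).prodMap i) (U ×ˢ univ) G →
      IsGateauxFamily n (ContinuousLinearMap.id ℝ X) U φ →
      IsGateauxFamily n (ContinuousLinearMap.id ℝ X) U fun p u => G p (u, i (φ p u)) := by
  have hUY : IsOpen (U ×ˢ (univ : Set Y)) := hU.prod isOpen_univ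
  have hgraph : ∀ {P : Type (max w uX uZ)} [TopologicalSpace P] {φ : P → X → Z},
      ContinuousOn (fun q : P × X => φ q.1 q.2) (univ ×ˢ U) →
      ContinuousOn (fun q : P × X => (q.1, (q.2, i (φ q.1 q.2)))) (univ ×ˢ U) := fun hφ =>
    continuousOn_fst.prodMk (continuousOn_snd.prodMk (i.continuous.comp_continuousOn hφ))
  induction n with
  | zero =>
    intro P _ G φ hG hφ
    rw [zero_iff] at hG hφ ⊢
    exact hG.comp (hgraph hφ) fun q hq => ⟨mem_univ _, hq.2, mem_univ _⟩
  | succ n ih =>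
    intro P _ G φ hG hφ
    set e := (ContinuousLinearMap.id ℝ X).prodMap i with he
    -- the differential of `G`, with arbitrary increments in `X × Z`, along the graph of `φ`
    have hL : IsGateauxFamily n (ContinuousLinearMap.id ℝ X) U
        fun (q : P × (X × Z)) u => _root_.lineDeriv ℝ (G q.1) (u, i (φ q.1 u)) (e q.2) :=
      ih (P := P × (X × Z)) (φ := fun q => φ q.1) hG.lineDeriv
        ((hφ.mono n.le_succ).comp_param continuous_fst)
    have hlin : ∀ p, ∀ u ∈ U, IsLinearMap ℝ fun ξ : X × Z =>
        _root_.lineDeriv ℝ (G p) (u, i (φ p u)) (e ξ) := fun p u hu =>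
      hG.isLinearMap_lineDeriv hUY p ⟨hu, mem_univ _⟩
    refine of_hasLineDerivAt hU ?_ (f' := fun q u =>
      _root_.lineDeriv ℝ (G q.1) (u, i (φ q.1 u)) (e (q.2, 0)) +
      _root_.lineDeriv ℝ (G q.1) (u, i (φ q.1 u)) (e (0, _root_.lineDeriv ℝ (φ q.1) u q.2)))
      ?_ (add hU ?_ ?_)
    · exact hG.continuousOn.comp (hgraph hφ.continuousOn) fun q hq => ⟨mem_univ _, hq.2, mem_univ _⟩
    · intro p u hu x
      have h2 := hφ.hasLineDerivAt p hu x
      rw [← (hlin p u hu).map_add, Prod.mk_add_mk, add_zero, zero_add]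
      rw [hasLineDerivAt_iff_tendsto_slope_zero] at h2 ⊢
      have h3 := tendsto_slope_comp (u := (u, i (φ p u))) (e := e) hUY (f := G p)
        (f' := fun z ξ => _root_.lineDeriv ℝ (G p) z (e ξ))
        (fun z hz ξ => hG.hasLineDerivAt p hz ξ)
        (hG.lineDeriv.continuousOn.comp (f := fun q : (X × Y) × (X × Z) => ((p, q.2), q.1))
          (by fun_prop) fun q hq => ⟨mem_univ _, hq.1⟩) ⟨hu, mem_univ _⟩
        ((tendsto_const_nhds (x := x)).prodMk_nhds h2)
      refine h3.congr' ?_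
      filter_upwards [self_mem_nhdsWithin] with t (ht : t ≠ 0)
      have : (u, i (φ p u)) + t • e (x, t⁻¹ • (φ p (u + t • x) - φ p u)) =
          (u + t • x, i (φ p (u + t • x))) := by
        simp [he, smul_smul, ht]
      simp only [ContinuousLinearMap.id_apply]
      rw [this]
    · exact hL.comp_param (r := fun q : P × X => (q.1, (q.2, 0))) (by fun_prop)
    · exact comp_linear_param.{max w uX uZ, uX, uZ, uX, uF} (P := P × X) hU
        (B := fun q u => _root_.lineDeriv ℝ (G q.1.1) (u, i (φ q.1.1 u)) (e (0, q.2)))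
        (v := fun q u => _root_.lineDeriv ℝ (φ q.1) u q.2)
        (hL.comp_param (r := fun q : (P × X) × Z => (q.1.1, (0, q.2))) (by fun_prop))
        (fun p u hu =>
          { map_add := fun z z' => by
              rw [← (hlin p.1 u hu).map_add, Prod.mk_add_mk, add_zero]
            map_smul := fun c z => by
              rw [← (hlin p.1 u hu).map_smul, Prod.smul_mk, smul_zero] })
        hφ.lineDeriv

end Rules

/-! ### Fixed points of uniform contractions -/

section FixedPoint

variable {V : Type*} [NormedAddCommGroup V] {α : ℝ}

theorem norm_sub_le_of_contraction {g : V → V} (hα : α < 1)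
    (hg : ∀ z z', ‖g z - g z'‖ ≤ α * ‖z - z'‖) {a : V} (ha : g a = a) (b : V) :
    ‖a - b‖ ≤ (1 - α)⁻¹ * ‖g b - b‖ := by
  have h1 : ‖a - b‖ ≤ α * ‖a - b‖ + ‖g b - b‖ := by
    calc ‖a - b‖ = ‖(g a - g b) + (g b - b)‖ := by rw [ha]; congr 1; abel
      _ ≤ _ := (norm_add_le _ _).trans (by gcongr; exact hg a b)
  rw [inv_mul_eq_div, le_div_iff₀ (by linarith)]
  linarith

theorem exists_fixed_of_contraction [CompleteSpace V] {g : V → V} (h0 : 0 ≤ α) (hα : α < 1)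
    (hg : ∀ z z', ‖g z - g z'‖ ≤ α * ‖z - z'‖) : ∃ a, g a = a := by
  have : ContractingWith ⟨α, h0⟩ g := ⟨by exact_mod_cast hα, LipschitzWith.of_dist_le_mul
    fun z z' => by rw [dist_eq_norm, dist_eq_norm]; exact hg z z'⟩
  exact ⟨this.fixedPoint g, this.fixedPoint_isFixedPt⟩

theorem eq_of_contraction {g : V → V} (hα : α < 1)
    (hg : ∀ z z', ‖g z - g z'‖ ≤ α * ‖z - z'‖) {a b : V} (ha : g a = a) (hb : g b = b) :
    a = b := by
  have := norm_sub_le_of_contraction hα hg ha b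
  rw [hb, sub_self, norm_zero, mul_zero] at this
  exact sub_eq_zero.1 (norm_le_zero_iff.1 this)

/-- A family of uniform Lipschitz maps which depends continuously on a parameter in the topology of
pointwise convergence is jointly continuous. -/
theorem continuousOn_of_uniform_lipschitz {Q : Type*} [TopologicalSpace Q] {S : Set Q}
    {T : Q → V → V} (hT : ∀ q ∈ S, ∀ z z', ‖T q z - T q z'‖ ≤ α * ‖z - z'‖)
    (hc : ∀ z, ContinuousOn (fun q => T q z) S) :
    ContinuousOn (fun p : Q × V => T p.1 p.2) (S ×ˢ univ) := by
  rintro ⟨q₀, z₀⟩ ⟨hq₀, -⟩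
  have hz : Tendsto (fun p : Q × V => p.2) (𝓝[S ×ˢ univ] (q₀, z₀)) (𝓝 z₀) :=
    (continuous_snd.tendsto (q₀, z₀)).mono_left nhdsWithin_le_nhds
  have hq : Tendsto (fun p : Q × V => p.1) (𝓝[S ×ˢ univ] (q₀, z₀)) (𝓝[S] q₀) :=
    tendsto_nhdsWithin_iff.2 ⟨(continuous_fst.tendsto (q₀, z₀)).mono_left nhdsWithin_le_nhds,
      eventually_mem_nhdsWithin.mono fun p hp => hp.1⟩
  have h1 : Tendsto (fun p : Q × V => T p.1 p.2 - T p.1 z₀) (𝓝[S ×ˢ univ] (q₀, z₀)) (𝓝 0) := by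
    refine squeeze_zero_norm' (a := fun p : Q × V => α * ‖p.2 - z₀‖)
      (eventually_mem_nhdsWithin.mono fun p hp => hT _ hp.1 _ _) ?_
    simpa using (hz.sub_const z₀).norm.const_mul α
  have h2 := h1.add ((hc z₀ q₀ hq₀).tendsto.comp hq)
  simpa [Function.comp_def, ContinuousWithinAt] using h2

/-- The fixed point of a uniform contraction depends continuously on the parameter. -/
theorem continuousOn_fixed {Q : Type*} [TopologicalSpace Q] {S : Set Q} {T : Q → V → V}
    {a : Q → V} (hα : α < 1) (hT : ∀ q ∈ S, ∀ z z', ‖T q z - T q z'‖ ≤ α * ‖z - z'‖)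
    (hc : ∀ z, ContinuousOn (fun q => T q z) S) (ha : ∀ q ∈ S, T q (a q) = a q) :
    ContinuousOn a S := by
  intro q₀ hq₀
  rw [ContinuousWithinAt, tendsto_iff_norm_sub_tendsto_zero]
  refine squeeze_zero' (Eventually.of_forall fun _ => norm_nonneg _)
    (g := fun q => (1 - α)⁻¹ * ‖T q (a q₀) - a q₀‖)
    (eventually_mem_nhdsWithin.mono fun q hq =>
      norm_sub_le_of_contraction hα (hT q hq) (ha q hq) _) ?_
  have h1 := ((hc (a q₀) q₀ hq₀).tendsto.sub_const (a q₀)).norm.const_mul (1 - α)⁻¹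
  simpa [ha q₀ hq₀] using h1

/-- The fixed point `a u` of a uniform contraction `T u` has the directional derivative `a'`, as
soon as this is what differentiating the equation `T u (a u) = a u` formally gives. No difference
quotient of `a` enters the hypothesis: `a u + t • a'` is an approximate fixed point of
`T (u + t • x)`, with an error `o(t)`, so that it is close to the fixed point. -/
theorem hasLineDerivAt_fixed [NormedSpace ℝ V] {E : Type*} [NormedAddCommGroup E]
    [NormedSpace ℝ E] {U : Set E} (hU : IsOpen U) {T : E → V → V} {a : E → V} (hα : α < 1)
    (hT : ∀ u ∈ U, ∀ z z', ‖T u z - T u z'‖ ≤ α * ‖z - z'‖) (ha : ∀ u ∈ U, T u (a u) = a u)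
    {u x : E} (hu : u ∈ U) {a' : V}
    (h : Tendsto (fun t : ℝ => t⁻¹ • (T (u + t • x) (a u + t • a') - a u)) (𝓝[≠] 0) (𝓝 a')) :
    HasLineDerivAt ℝ a a' u x := by
  rw [hasLineDerivAt_iff_tendsto_slope_zero, tendsto_iff_norm_sub_tendsto_zero]
  refine squeeze_zero' (Eventually.of_forall fun _ => norm_nonneg _)
    (g := fun t : ℝ => (1 - α)⁻¹ * ‖t⁻¹ • (T (u + t • x) (a u + t • a') - a u) - a'‖) ?_ ?_
  · filter_upwards [(tendsto_add_smul u x).eventually (hU.eventually_mem hu),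
      self_mem_nhdsWithin] with t ht (ht0 : t ≠ 0)
    have h1 := norm_sub_le_of_contraction hα (hT _ ht) (ha _ ht) (a u + t • a')
    have aux : ∀ w : V, ‖t⁻¹ • (w - a u) - a'‖ = ‖t⁻¹‖ * ‖w - (a u + t • a')‖ := fun w => by
      rw [← norm_smul, ← sub_sub, smul_sub _ _ (t • a'), inv_smul_smul₀ ht0]
    rw [aux, aux, mul_left_comm]
    exact mul_le_mul_of_nonneg_left h1 (norm_nonneg _)
  · simpa using (tendsto_iff_norm_sub_tendsto_zero.1 h).const_mul (1 - α)⁻¹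

end FixedPoint

/-! ### Regularity of solutions of linear fixed-point equations -/

section LinearEquation

universe w uX uZ uV

/-- The derivative `d` of a solution of the linear equation `v = A v + b` exists, and it solves the
linear equation `d = A d + c` with `c = (∂A) v + ∂b`. -/
theorem exists_lineDeriv_of_linear_equation {X : Type uX} {Z : Type uZ} {V : Type uV}
    [NormedAddCommGroup X] [NormedSpace ℝ X] [NormedAddCommGroup Z] [NormedSpace ℝ Z]
    [NormedAddCommGroup V] [NormedSpace ℝ V] [CompleteSpace V]
    {i : Z →L[ℝ] V} {U : Set X} (hU : IsOpen U) {α : ℝ} (h0 : 0 ≤ α) (hα : α < 1) {n : ℕ}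
    {P : Type (max w uX)} [TopologicalSpace P] {A : P → X → V → V} {b : P → X → V}
    {v : P → X → Z} (hl : ∀ p, ∀ u ∈ U, IsLinearMap ℝ (A p u))
    (hc : ∀ p, ∀ u ∈ U, ∀ z, ‖A p u z‖ ≤ α * ‖z‖)
    (hA : ∀ z, ContinuousOn (fun q : P × X => A q.1 q.2 z) (univ ×ˢ U))
    (hAG : IsGateauxFamily (n + 1) (ContinuousLinearMap.id ℝ X) U
      (fun (q : P × Z) u => A q.1 u (i q.2)))
    (hb : IsGateauxFamily (n + 1) (ContinuousLinearMap.id ℝ X) U b)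
    (hv : IsGateauxFamily n (ContinuousLinearMap.id ℝ X) U v)
    (heq : ∀ p, ∀ u ∈ U, A p u (i (v p u)) + b p u = i (v p u)) :
    ∃ c d : P × X → X → V, IsGateauxFamily n (ContinuousLinearMap.id ℝ X) U c ∧
      ContinuousOn (fun q : (P × X) × X => d q.1 q.2) (univ ×ˢ U) ∧
      (∀ q, ∀ u ∈ U, A q.1 u (d q u) + c q u = d q u) ∧
      ∀ p, ∀ u ∈ U, ∀ x, HasLineDerivAt ℝ (fun u => i (v p u)) (d (p, x) u) u x := by
  have hcontr : ∀ p, ∀ u ∈ U, ∀ c z z', ‖(A p u z + c) - (A p u z' + c)‖ ≤ α * ‖z - z'‖ := by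
    intro p u hu c z z'
    rw [add_sub_add_right_eq_sub, ← (hl p u hu).map_sub]
    exact hc p u hu _
  have hcG : IsGateauxFamily n (ContinuousLinearMap.id ℝ X) U fun (q : P × X) u =>
      lineDeriv ℝ (fun w => A q.1 w (i (v q.1 u))) u q.2 + lineDeriv ℝ (b q.1) u q.2 := by
    refine IsGateauxFamily.add hU ?_ hb.lineDeriv
    exact IsGateauxFamily.comp_linear_param.{max w uX, uX, uZ, uX, uV} (P := P × X) hU
      (B := fun q u => lineDeriv ℝ (fun w => A q.1.1 w (i q.2)) u q.1.2) (v := fun q => v q.1)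
      (hAG.lineDeriv.comp_param (r := fun q : (P × X) × Z => ((q.1.1, q.2), q.1.2))
        (by fun_prop))
      (fun p u hu => by
        constructor
        · intro z z'
          refine HasLineDerivAt.lineDeriv (Set.EqOn.hasLineDerivAt hU
            (fun w hw => ?_) hu ((hAG.hasLineDerivAt (p.1, z) hu p.2).add
              (hAG.hasLineDerivAt (p.1, z') hu p.2)))
          simp only [map_add, (hl p.1 w hw).map_add]
        · intro c z
          refine HasLineDerivAt.lineDeriv (Set.EqOn.hasLineDerivAt hU
            (fun w hw => ?_) hu ((hAG.hasLineDerivAt (p.1, z) hu p.2).const_smul c))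
          simp only [map_smul, (hl p.1 w hw).map_smul])
      (hv.comp_param continuous_fst)
  set c : P × X → X → V := fun q u =>
    lineDeriv ℝ (fun w => A q.1 w (i (v q.1 u))) u q.2 + lineDeriv ℝ (b q.1) u q.2 with hcdef
  have hex : ∀ q : P × X, ∀ u, ∃ a, u ∈ U → A q.1 u a + c q u = a := fun q u => by
    by_cases hu : u ∈ U
    · obtain ⟨a, ha⟩ := exists_fixed_of_contraction h0 hα (hcontr q.1 u hu (c q u))
      exact ⟨a, fun _ => ha⟩
    · exact ⟨0, fun h => absurd h hu⟩
  choose d hd using hex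
  refine ⟨c, d, hcG, ?_, hd, ?_⟩
  · refine continuousOn_fixed (T := fun (q : (P × X) × X) z => A q.1.1 q.2 z + c q.1 q.2) hα
      (fun q hq => hcontr _ _ hq.2 _) (fun z => ContinuousOn.add ?_ hcG.continuousOn)
      (fun q hq => hd _ _ hq.2)
    exact (hA z).comp (f := fun q : (P × X) × X => (q.1.1, q.2)) (by fun_prop)
      fun q hq => ⟨mem_univ _, hq.2⟩
  · intro p u hu x
    refine hasLineDerivAt_fixed hU (T := fun u z => A p u z + b p u) hα
      (fun u hu => hcontr p u hu _) (heq p) hu ?_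
    have h1 := hAG.hasLineDerivAt (p, v p u) hu x
    have h2 := hb.hasLineDerivAt p hu x
    rw [hasLineDerivAt_iff_tendsto_slope_zero] at h1 h2
    have h3 : Tendsto (fun t : ℝ => A p (u + t • x) (d (p, x) u)) (𝓝[≠] 0)
        (𝓝 (A p u (d (p, x) u))) :=
      ((hA (d (p, x) u)).continuousAt ((isOpen_univ.prod hU).mem_nhds
        (x := (p, u)) ⟨mem_univ _, hu⟩)).tendsto.comp
        (tendsto_const_nhds.prodMk_nhds (tendsto_add_smul u x))
    have h4 := h3.add (h1.add h2)
    have h5 : A p u (d (p, x) u) + c (p, x) u = d (p, x) u := hd (p, x) u hu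
    simp only [ContinuousLinearMap.id_apply] at h4
    rw [hcdef] at h5
    simp only at h5
    rw [h5] at h4
    refine h4.congr' ?_
    filter_upwards [(tendsto_add_smul u x).eventually (hU.eventually_mem hu),
      self_mem_nhdsWithin] with t ht (ht0 : t ≠ 0)
    have hlt := hl p _ ht
    rw [hlt.map_add, hlt.map_smul]
    have h6 : A p (u + t • x) (i (v p u)) + t • A p (u + t • x) (d (p, x) u) + b p (u + t • x) -
        i (v p u) = t • A p (u + t • x) (d (p, x) u) + (A p (u + t • x) (i (v p u)) -
        A p u (i (v p u)) + (b p (u + t • x) - b p u)) := by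
      calc _ = A p (u + t • x) (i (v p u)) + t • A p (u + t • x) (d (p, x) u) +
            b p (u + t • x) - (A p u (i (v p u)) + b p u) := by rw [heq p u hu]
        _ = _ := by abel
    rw [h6, ← smul_add, smul_add _ (t • _), inv_smul_smul₀ ht0]

/-- Regularity for the linear equation `v = A v + b`, where `A p u` is a uniform linear contraction
of `V`. If `v` is of class `𝒢ʲ` with values in the smaller space `Z`, and the data are of class
`𝒢ʲ⁺¹` (as far as `A` is concerned, only after being applied to elements of `Z`), then `v` is of
class `𝒢ʲ⁺¹` with values in `V`. The derivatives of `v` solve an equation of the same type. -/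
theorem isGateauxFamily_of_linear_equation {X : Type uX} {Z : Type uZ} {V : Type uV}
    [NormedAddCommGroup X] [NormedSpace ℝ X] [NormedAddCommGroup Z] [NormedSpace ℝ Z]
    [NormedAddCommGroup V] [NormedSpace ℝ V] [CompleteSpace V]
    {i : Z →L[ℝ] V} {U : Set X} (hU : IsOpen U) {α : ℝ} (h0 : 0 ≤ α) (hα : α < 1) {n : ℕ} :
    ∀ {P : Type (max w uX)} [TopologicalSpace P] {A : P → X → V → V} {b : P → X → V}
      {v : P → X → Z}, (∀ p, ∀ u ∈ U, IsLinearMap ℝ (A p u)) →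
      (∀ p, ∀ u ∈ U, ∀ z, ‖A p u z‖ ≤ α * ‖z‖) →
      (∀ z, ContinuousOn (fun q : P × X => A q.1 q.2 z) (univ ×ˢ U)) →
      IsGateauxFamily (n + 1) (ContinuousLinearMap.id ℝ X) U
        (fun (q : P × Z) u => A q.1 u (i q.2)) →
      IsGateauxFamily (n + 1) (ContinuousLinearMap.id ℝ X) U b →
      IsGateauxFamily n (ContinuousLinearMap.id ℝ X) U v →
      (∀ p, ∀ u ∈ U, A p u (i (v p u)) + b p u = i (v p u)) →
      IsGateauxFamily (n + 1) (ContinuousLinearMap.id ℝ X) U fun p u => i (v p u) := by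
  induction n with
  | zero =>
    intro P _ A b v hl hc hA hAG hb hv heq
    obtain ⟨c, d, -, hd, -, hder⟩ :=
      exists_lineDeriv_of_linear_equation.{w, uX, uZ, uV} hU h0 hα hl hc hA hAG hb hv heq
    exact IsGateauxFamily.of_hasLineDerivAt hU (i.continuous.comp_continuousOn hv.continuousOn)
      hder (IsGateauxFamily.zero_iff.2 hd)
  | succ n ih =>
    intro P _ A b v hl hc hA hAG hb hv heq
    obtain ⟨c, d, hcG, -, hdeq, hder⟩ :=
      exists_lineDeriv_of_linear_equation.{w, uX, uZ, uV} hU h0 hα hl hc hA hAG hb hv heq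
    have hd : ∀ q : P × X, ∀ u ∈ U, d q u = i (lineDeriv ℝ (v q.1) u q.2) := fun q u hu =>
      (hder q.1 u hu q.2).unique (i.hasFDerivAt.comp_hasDerivAt (0 : ℝ)
        (hv.hasLineDerivAt q.1 hu q.2))
    refine IsGateauxFamily.of_hasLineDerivAt hU
      (i.continuous.comp_continuousOn hv.continuousOn) hder (IsGateauxFamily.congr hU ?_ hd)
    refine ih (P := P × X) (A := fun q => A q.1) (b := c) (fun q => hl q.1) (fun q => hc q.1)
      (fun z => ?_) ?_ hcG hv.lineDeriv (fun q u hu => ?_)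
    · exact (hA z).comp (f := fun q : (P × X) × X => (q.1.1, q.2)) (by fun_prop)
        fun q hq => ⟨mem_univ _, hq.2⟩
    · exact (hAG.mono (n + 1).le_succ).comp_param (r := fun q : (P × X) × Z => (q.1.1, q.2))
        (by fun_prop)
    · have := hdeq q u hu
      rwa [hd q u hu] at this

end LinearEquation

/-! ### Regularity of the fixed-point map -/

section ParametricContraction

universe w uX uZ uV

variable {X : Type uX} {V : Type uV} [NormedAddCommGroup X] [NormedSpace ℝ X]
  [NormedAddCommGroup V] [NormedSpace ℝ V] {U : Set X} {α : ℝ}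

/-- The linear map `∂_y H(u, φ u)` has the properties required of `A` in
`isGateauxFamily_of_linear_equation`. -/
theorem partial_snd_properties {P : Type*} [TopologicalSpace P] (hU : IsOpen U)
    {H : P → X × V → V} {φ : P → X → V}
    (hH : ∀ p, ∀ u ∈ U, ∀ y y', ‖H p (u, y) - H p (u, y')‖ ≤ α * ‖y - y'‖)
    (hsnd : IsGateauxFamily 1 (ContinuousLinearMap.inr ℝ X V) (U ×ˢ univ) H)
    (hφ : ContinuousOn (fun q : P × X => φ q.1 q.2) (univ ×ˢ U)) :
    (∀ p, ∀ u ∈ U, IsLinearMap ℝ fun z => lineDeriv ℝ (H p) (u, φ p u) (0, z)) ∧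
    (∀ p, ∀ u ∈ U, ∀ z, ‖lineDeriv ℝ (H p) (u, φ p u) (0, z)‖ ≤ α * ‖z‖) ∧
    ∀ z, ContinuousOn (fun q : P × X => lineDeriv ℝ (H q.1) (q.2, φ q.1 q.2) (0, z))
      (univ ×ˢ U) := by
  have hUV : IsOpen (U ×ˢ (univ : Set V)) := hU.prod isOpen_univ
  refine ⟨fun p u hu => hsnd.isLinearMap_lineDeriv hUV p ⟨hu, mem_univ _⟩, fun p u hu z => ?_,
    fun z => ?_⟩
  · have h1 := hsnd.hasLineDerivAt p (u := (u, φ p u)) ⟨hu, mem_univ _⟩ z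
    rw [hasLineDerivAt_iff_tendsto_slope_zero] at h1
    refine le_of_tendsto h1.norm ?_
    filter_upwards [self_mem_nhdsWithin] with t (ht : t ≠ 0)
    have h2 := hH p u hu (φ p u + t • z) (φ p u)
    have h3 : (u, φ p u) + t • (ContinuousLinearMap.inr ℝ X V) z = (u, φ p u + t • z) := by simp
    rw [h3, norm_smul, norm_inv, inv_mul_le_iff₀ (norm_pos_iff.2 ht)]
    rw [add_sub_cancel_left, norm_smul] at h2
    linarith
  · exact hsnd.lineDeriv.continuousOn.comp
      (f := fun q : P × X => ((q.1, z), (q.2, φ q.1 q.2)))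
      ((continuousOn_fst.prodMk continuousOn_const).prodMk (continuousOn_snd.prodMk hφ))
      fun q hq => ⟨mem_univ _, hq.2, mem_univ _⟩

/-- The fixed-point map `φ` of a parametric contraction of class `𝒢¹` is of class `𝒢¹`, and its
derivative solves the linear equation `∂φ = ∂_y H(u, φ u) ∂φ + ∂_x H(u, φ u)`. -/
theorem isGateauxFamily_one_fixed [CompleteSpace V] {P : Type*} [TopologicalSpace P] (hU : IsOpen U)
    (h0 : 0 ≤ α) (hα : α < 1) {H : P → X × V → V} {φ : P → X → V}
    (hH : ∀ p, ∀ u ∈ U, ∀ y y', ‖H p (u, y) - H p (u, y')‖ ≤ α * ‖y - y'‖)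
    (hfst : IsGateauxFamily 1 (ContinuousLinearMap.inl ℝ X V) (U ×ˢ univ) H)
    (hsnd : IsGateauxFamily 1 (ContinuousLinearMap.inr ℝ X V) (U ×ˢ univ) H)
    (hφ : ∀ p, ∀ u ∈ U, H p (u, φ p u) = φ p u) :
    IsGateauxFamily 1 (ContinuousLinearMap.id ℝ X) U φ ∧ ∀ p, ∀ u ∈ U, ∀ x,
      lineDeriv ℝ (H p) (u, φ p u) (0, lineDeriv ℝ (φ p) u x) +
        lineDeriv ℝ (H p) (u, φ p u) (x, 0) = lineDeriv ℝ (φ p) u x := by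
  have hUV : IsOpen (U ×ˢ (univ : Set V)) := hU.prod isOpen_univ
  have hφc : ContinuousOn (fun q : P × X => φ q.1 q.2) (univ ×ˢ U) :=
    continuousOn_fixed (T := fun (q : P × X) z => H q.1 (q.2, z)) hα (fun q hq => hH _ _ hq.2)
      (fun z => hsnd.continuousOn.comp (f := fun q : P × X => (q.1, (q.2, z))) (by fun_prop)
        fun q hq => ⟨mem_univ _, hq.2, mem_univ _⟩) (fun q hq => hφ _ _ hq.2)
  obtain ⟨hl, hc, hA⟩ := partial_snd_properties hU hH hsnd hφc
  have hcontr : ∀ p, ∀ u ∈ U, ∀ c z z', ‖(lineDeriv ℝ (H p) (u, φ p u) (0, z) + c) -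
      (lineDeriv ℝ (H p) (u, φ p u) (0, z') + c)‖ ≤ α * ‖z - z'‖ := by
    intro p u hu c z z'
    rw [add_sub_add_right_eq_sub, ← (hl p u hu).map_sub]
    exact hc p u hu _
  have hb : ContinuousOn (fun q : (P × X) × X =>
      lineDeriv ℝ (H q.1.1) (q.2, φ q.1.1 q.2) (q.1.2, 0)) (univ ×ˢ U) := by
    refine hfst.lineDeriv.continuousOn.comp
      (f := fun q : (P × X) × X => (q.1, (q.2, φ q.1.1 q.2)))
      (continuousOn_fst.prodMk (continuousOn_snd.prodMk ?_))
      fun q hq => ⟨mem_univ _, hq.2, mem_univ _⟩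
    exact hφc.comp (f := fun q : (P × X) × X => (q.1.1, q.2)) (by fun_prop)
      fun q hq => ⟨mem_univ _, hq.2⟩
  have hex : ∀ q : P × X, ∀ u, ∃ a, u ∈ U → lineDeriv ℝ (H q.1) (u, φ q.1 u) (0, a) +
      lineDeriv ℝ (H q.1) (u, φ q.1 u) (q.2, 0) = a := fun q u => by
    by_cases hu : u ∈ U
    · obtain ⟨a, ha⟩ := exists_fixed_of_contraction h0 hα (hcontr q.1 u hu
        (lineDeriv ℝ (H q.1) (u, φ q.1 u) (q.2, 0)))
      exact ⟨a, fun _ => ha⟩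
    · exact ⟨0, fun h => absurd h hu⟩
  choose d hd using hex
  have hder : ∀ p, ∀ u ∈ U, ∀ x, HasLineDerivAt ℝ (φ p) (d (p, x) u) u x := by
    intro p u hu x
    refine hasLineDerivAt_fixed hU (T := fun u z => H p (u, z)) hα (hH p) (hφ p) hu ?_
    have h1 := HasLineDerivAt.add_of_continuousOn hUV
      (fun z hz => hsnd.hasLineDerivAt p hz (d (p, x) u))
      ((hsnd.hasContinuousDirDerivs p).continuousOn_lineDeriv (d (p, x) u))
      (u := (u, φ p u)) ⟨hu, mem_univ _⟩
      (hfst.hasLineDerivAt p (u := (u, φ p u)) ⟨hu, mem_univ _⟩ x)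
    simp only [ContinuousLinearMap.inl_apply, ContinuousLinearMap.inr_apply] at h1
    rw [add_comm (lineDeriv ℝ (H p) (u, φ p u) (x, 0)), hd (p, x) u hu,
      hasLineDerivAt_iff_tendsto_slope_zero] at h1
    refine h1.congr fun t => ?_
    rw [hφ p u hu]
    simp
  refine ⟨IsGateauxFamily.of_hasLineDerivAt hU hφc hder (IsGateauxFamily.zero_iff.2 ?_),
    fun p u hu x => ?_⟩
  · refine continuousOn_fixed (T := fun (q : (P × X) × X) z =>
      lineDeriv ℝ (H q.1.1) (q.2, φ q.1.1 q.2) (0, z) +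
        lineDeriv ℝ (H q.1.1) (q.2, φ q.1.1 q.2) (q.1.2, 0)) hα
      (fun q hq => hcontr _ _ hq.2 _) (fun z => ContinuousOn.add ?_ hb)
      (fun q hq => hd _ _ hq.2)
    exact (hA z).comp (f := fun q : (P × X) × X => (q.1.1, q.2)) (by fun_prop)
      fun q hq => ⟨mem_univ _, hq.2⟩
  · rw [(hder p u hu x).lineDeriv]
    exact hd (p, x) u hu

/-- One step on the scale of spaces: if the fixed-point map is of class `𝒢ⁿ` with values in `Z`,
then it is of class `𝒢ⁿ⁺¹` with values in the larger space `V`. -/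
theorem isGateauxFamily_succ_fixed [CompleteSpace V] {Z : Type uZ} [NormedAddCommGroup Z] [NormedSpace ℝ Z]
    {i : Z →L[ℝ] V} {P : Type (max w uX uZ)} [TopologicalSpace P] (hU : IsOpen U)
    (h0 : 0 ≤ α) (hα : α < 1) {H : P → X × V → V} {φ : P → X → V} {ψ : P → X → Z} {n : ℕ}
    (hH : ∀ p, ∀ u ∈ U, ∀ y y', ‖H p (u, y) - H p (u, y')‖ ≤ α * ‖y - y'‖)
    (hfst : IsGateauxFamily 1 (ContinuousLinearMap.inl ℝ X V) (U ×ˢ univ) H)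
    (hsnd : IsGateauxFamily 1 (ContinuousLinearMap.inr ℝ X V) (U ×ˢ univ) H)
    (hprod : IsGateauxFamily (n + 2) ((ContinuousLinearMap.id ℝ X).prodMap i) (U ×ˢ univ) H)
    (hφ : ∀ p, ∀ u ∈ U, H p (u, φ p u) = φ p u) (hψ : ∀ p, ∀ u ∈ U, i (ψ p u) = φ p u)
    (hψG : IsGateauxFamily (n + 1) (ContinuousLinearMap.id ℝ X) U ψ) :
    IsGateauxFamily (n + 2) (ContinuousLinearMap.id ℝ X) U φ := by
  obtain ⟨h1, heq⟩ := isGateauxFamily_one_fixed hU h0 hα hH hfst hsnd hφ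
  obtain ⟨hl, hc, hA⟩ := partial_snd_properties hU hH hsnd h1.continuousOn
  refine IsGateauxFamily.of_hasLineDerivAt hU h1.continuousOn
    (f' := fun q u => lineDeriv ℝ (φ q.1) u q.2) (fun p u hu x => h1.hasLineDerivAt p hu x) ?_
  -- the differential of `H` along the graph of the fixed-point map
  have hL : IsGateauxFamily (n + 1) (ContinuousLinearMap.id ℝ X) U
      fun (q : P × (X × Z)) u =>
        lineDeriv ℝ (H q.1) (u, i (ψ q.1 u)) ((ContinuousLinearMap.id ℝ X).prodMap i q.2) :=
    IsGateauxFamily.comp_graph.{max w uX uZ, uX, uZ, uV, uV} (P := P × (X × Z)) hU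
      (φ := fun q => ψ q.1) hprod.lineDeriv (hψG.comp_param continuous_fst)
  have hdψ : ∀ q : P × X, ∀ u ∈ U, lineDeriv ℝ (φ q.1) u q.2 = i (lineDeriv ℝ (ψ q.1) u q.2) :=
    fun q u hu => HasLineDerivAt.lineDeriv (Set.EqOn.hasLineDerivAt hU
      (fun w hw => (hψ q.1 w hw).symm) hu (i.hasFDerivAt.comp_hasDerivAt (0 : ℝ)
        (hψG.hasLineDerivAt q.1 hu q.2)))
  refine IsGateauxFamily.congr hU ?_ hdψ
  refine isGateauxFamily_of_linear_equation.{max w uX uZ, uX, uZ, uV} (P := P × X) hU h0 hα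
    (A := fun q u z => lineDeriv ℝ (H q.1) (u, φ q.1 u) (0, z))
    (b := fun q u => lineDeriv ℝ (H q.1) (u, φ q.1 u) (q.2, 0))
    (v := fun q u => lineDeriv ℝ (ψ q.1) u q.2)
    (fun q => hl q.1) (fun q => hc q.1) (fun z => ?_) ?_ ?_ hψG.lineDeriv (fun q u hu => ?_)
  · exact (hA z).comp (f := fun q : (P × X) × X => (q.1.1, q.2)) (by fun_prop)
      fun q hq => ⟨mem_univ _, hq.2⟩
  · refine IsGateauxFamily.congr hU (hL.comp_param
      (r := fun q : (P × X) × Z => (q.1.1, (0, q.2))) (by fun_prop)) fun q u hu => ?_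
    simp [hψ _ _ hu]
  · refine IsGateauxFamily.congr hU (hL.comp_param
      (r := fun q : P × X => (q.1, (q.2, 0))) (by fun_prop)) fun q u hu => ?_
    simp [hψ _ _ hu]
  · rw [← hdψ q u hu]
    exact heq q.1 u hu q.2

end ParametricContraction

/-! ### Uniform convergence on compact sets as joint continuity -/

section Convergence

variable {Q F : Type*} [TopologicalSpace Q] [NormedAddCommGroup F] {S : Set Q} {f : ℕ∞ → Q → F}

/-- A sequence of continuous functions which converges uniformly on compact sets is a jointly
continuous function on `ℕ∞ × S`, the value at `⊤` being the limit. -/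
theorem continuousOn_of_tendstoUniformlyOn [FirstCountableTopology Q]
    (hc : ∀ p, ContinuousOn (f p) S)
    (hK : ∀ K ⊆ S, IsCompact K → TendstoUniformlyOn (fun m : ℕ => f m) (f ⊤) atTop K) :
    ContinuousOn (fun q : ℕ∞ × Q => f q.1 q.2) (univ ×ˢ S) := by
  classical
  rintro ⟨p, q₀⟩ ⟨-, hq₀⟩
  have hsnd : Tendsto (fun q : ℕ∞ × Q => q.2) (𝓝[univ ×ˢ S] (p, q₀)) (𝓝[S] q₀) :=
    tendsto_nhdsWithin_iff.2 ⟨(continuous_snd.tendsto (p, q₀)).mono_left nhdsWithin_le_nhds,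
      eventually_mem_nhdsWithin.mono fun q hq => hq.2⟩
  have hfst : Tendsto (fun q : ℕ∞ × Q => q.1) (𝓝[univ ×ˢ S] (p, q₀)) (𝓝 p) :=
    (continuous_fst.tendsto (p, q₀)).mono_left nhdsWithin_le_nhds
  induction p using ENat.recTopCoe with
  | coe m =>
    rw [ENat.nhds_natCast, tendsto_pure] at hfst
    refine (((hc m) q₀ hq₀).tendsto.comp hsnd).congr' ?_
    filter_upwards [hfst] with q hq
    simp [hq]
  | top =>
    refine tendsto_of_seq_tendsto fun s hs => ?_
    have h1 := hfst.comp hs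
    have h2 := hsnd.comp hs
    have hS := (tendsto_nhdsWithin_iff.1 h2).2
    -- The finitely many points outside of `S` are moved, to get a compact subset of `S`.
    let q : ℕ → Q := fun i => if (s i).2 ∈ S then (s i).2 else q₀
    have hqs : ∀ᶠ i in atTop, q i = (s i).2 := hS.mono fun i hi => if_pos hi
    have hqS : ∀ i, q i ∈ S := fun i => by
      by_cases h : (s i).2 ∈ S
      · simpa only [q, if_pos h] using h
      · simpa only [q, if_neg h] using hq₀
    have hq : Tendsto q atTop (𝓝 q₀) :=
      (tendsto_nhdsWithin_iff.1 h2).1.congr' (hqs.mono fun i hi => hi.symm)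
    have hunif := Metric.tendstoUniformlyOn_iff.1 (hK (insert q₀ (range q))
      (insert_subset hq₀ (range_subset_iff.2 hqS)) hq.isCompact_insert_range)
    have hlim : Tendsto (fun i => f ⊤ (q i)) atTop (𝓝 (f ⊤ q₀)) :=
      ((hc ⊤) q₀ hq₀).tendsto.comp
        (tendsto_nhdsWithin_iff.2 ⟨hq, Eventually.of_forall hqS⟩)
    rw [Metric.tendsto_nhds]
    intro ε hε
    obtain ⟨N, hN⟩ := eventually_atTop.1 (hunif (ε / 2) (half_pos hε))
    filter_upwards [ENat.tendsto_nhds_top_iff_natCast_lt.1 h1 N, hqs,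
      Metric.tendsto_nhds.1 hlim (ε / 2) (half_pos hε)] with i hi hqi hl
    rw [hqi] at hl
    have h3 : dist (f (s i).1 (s i).2) (f ⊤ (s i).2) < ε / 2 := by
      generalize hp : (s i).1 = p
      have hi' : (N : ℕ∞) < p := by rw [← hp]; exact hi
      induction p using ENat.recTopCoe with
      | top => rw [dist_self]; exact half_pos hε
      | coe m =>
        rw [dist_comm, ← hqi]
        exact hN m (by exact_mod_cast hi'.le) _ (mem_insert_of_mem _ (mem_range_self i))
    calc _ ≤ _ := dist_triangle _ (f ⊤ (s i).2) _
      _ < ε / 2 + ε / 2 := add_lt_add h3 hl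
      _ = ε := add_halves ε

/-- Conversely, joint continuity on `ℕ∞ × K`, where `K` is compact, gives uniform convergence on
`K`. -/
theorem tendstoUniformlyOn_of_continuousOn {K : Set Q} (hK : IsCompact K)
    (hf : ContinuousOn (fun q : ℕ∞ × Q => f q.1 q.2) (univ ×ˢ K)) :
    TendstoUniformlyOn (fun m : ℕ => f m) (f ⊤) atTop K := by
  rw [Metric.tendstoUniformlyOn_iff]
  intro ε hε
  obtain ⟨v, hv, hvK⟩ := hK.mem_uniformity_of_prod (f := f) hf (mem_univ ⊤)
    (Metric.dist_mem_uniformity hε)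
  rw [nhdsWithin_univ] at hv
  filter_upwards [ENat.tendsto_natCast_nhds_top.eventually hv] with m hm x hx
  rw [dist_comm]
  exact hvK m hm x hx

end Convergence

/-- Up to a permutation, the entries of `s.piecewise a b` are those of `a` with index in `s`, followed
by those of `b` with index in the complement of `s`. -/
theorem List.ofFn_piecewise_perm {A : Type*} {j : ℕ} (s : Finset (Fin j)) (a b : Fin j → A) :
    (List.ofFn (s.piecewise a b)).Perm
      ((List.ofFn fun l => a (s.orderEmbOfFin rfl l)) ++
        List.ofFn fun l => b (sᶜ.orderEmbOfFin rfl l)) := by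
  rw [← Multiset.coe_eq_coe, ← Multiset.coe_add, ← Fin.univ_val_map, ← Fin.univ_val_map,
    ← Fin.univ_val_map]
  have h : ∀ (t : Finset (Fin j)) (c : Fin j → A),
      Multiset.map (fun l => c (t.orderEmbOfFin rfl l)) Finset.univ.val =
        Multiset.map c t.val := fun t c => by
    conv_rhs => rw [← Finset.map_orderEmbOfFin_univ t rfl]
    rw [Finset.map_val, Multiset.map_map]
    rfl
  have hu : (Finset.univ : Finset (Fin j)).val = s.val + sᶜ.val := by
    rw [← Finset.union_compl s, ← Finset.disjUnion_eq_union _ _ disjoint_compl_right]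
    rfl
  rw [h, h, hu, Multiset.map_add]
  congr 1
  · exact Multiset.map_congr rfl fun l hl => Finset.piecewise_eq_of_mem _ _ _ hl
  · exact Multiset.map_congr rfl fun l hl =>
      Finset.piecewise_eq_of_notMem _ _ _ (Finset.mem_compl.1 hl)

/-! ### Increments sorted by their component -/

section Increments

variable {X Z V : Type*} [NormedAddCommGroup X] [NormedSpace ℝ X]
  [NormedAddCommGroup Z] [NormedSpace ℝ Z] [NormedAddCommGroup V] [NormedSpace ℝ V]
  {i : Z →L[ℝ] V} {U : Set X} {n : ℕ}

/-- Multilinearity and symmetry express a derivative of order `j` with arbitrary increments in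
`X × Z` by the derivatives whose increments are first in `X`, then in `Z`. -/
theorem HasContinuousDirDerivs.eq_sum_incrementList {F : Type*} [NormedAddCommGroup F]
    [NormedSpace ℝ F] (hU : IsOpen U) {f : X × V → F}
    (h : HasContinuousDirDerivs n ((ContinuousLinearMap.id ℝ X).prodMap i) (U ×ˢ univ) f) {j : ℕ}
    (hj : j ≤ n) {z : X × V} (hz : z ∈ U ×ˢ (univ : Set V)) (v : Fin j → X × Z) :
    _root_.iterDirDeriv (List.ofFn fun l => (ContinuousLinearMap.id ℝ X).prodMap i (v l)) f z =
      ∑ s : Finset (Fin j), _root_.iterDirDeriv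
        (incrementList i (fun l => (v (s.orderEmbOfFin rfl l)).1)
          fun l => (v (sᶜ.orderEmbOfFin rfl l)).2) f z := by
  have hUV : IsOpen (U ×ˢ (univ : Set V)) := hU.prod isOpen_univ
  have hv : v = (fun l => ((v l).1, (0 : Z))) + fun l => ((0 : X), (v l).2) := by
    ext l <;> simp
  have h1 := (h.multilinear hUV hj hz).map_add_univ (fun l => ((v l).1, (0 : Z)))
    fun l => ((0 : X), (v l).2)
  rw [← hv] at h1
  refine Eq.trans h1 (Finset.sum_congr rfl fun s _ => ?_)
  have h2 := HasContinuousDirDerivs.iterDirDeriv_perm hUV (List.ofFn_piecewise_perm s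
    (fun l => ((v l).1, (0 : Z))) fun l => ((0 : X), (v l).2)) (h.mono (by simpa using hj)) hz
  simp only [List.map_append, List.map_ofFn] at h2
  refine h2.trans ?_
  simp [incrementList, Function.comp_def]

theorem IsGateauxFamily.continuousOn_incrementList {P F : Type*} [TopologicalSpace P]
    [NormedAddCommGroup F] [NormedSpace ℝ F] {f : P → X × V → F}
    (h : IsGateauxFamily n ((ContinuousLinearMap.id ℝ X).prodMap i) (U ×ˢ univ) f) {j l : ℕ}
    (hjl : j + l ≤ n) (p : P) :
    ContinuousOn (fun q : (X × V) × (Fin j → X) × (Fin l → Z) =>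
      iterDirDeriv (incrementList i q.2.1 q.2.2) (f p) q.1) ((U ×ˢ univ) ×ˢ univ) := by
  have h1 := (h (j + l) hjl).2.comp (s := (U ×ˢ univ) ×ˢ univ)
    (f := fun q : (X × V) × (Fin j → X) × (Fin l → Z) => ((p, q.1),
      (Fin.append (fun a => (q.2.1 a, (0 : Z))) fun a => ((0 : X), q.2.2 a) :
        Fin (j + l) → X × Z)))
    (by
      refine Continuous.continuousOn (Continuous.prodMk (by fun_prop) (continuous_pi fun a => ?_))
      induction a using Fin.addCases with
      | left a => simp only [Fin.append_left]; fun_prop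
      | right a => simp only [Fin.append_right]; fun_prop)
    fun q hq => ⟨⟨mem_univ _, hq.1⟩, mem_univ _⟩
  refine h1.congr fun q _ => ?_
  have h2 : ∀ v : Fin (j + l) → X × Z,
      (List.ofFn fun a => (ContinuousLinearMap.id ℝ X).prodMap i (v a)) =
        (List.ofFn v).map ((ContinuousLinearMap.id ℝ X).prodMap i) := fun v => by
    rw [List.map_ofFn]; rfl
  simp only [Function.comp, h2, List.ofFn_fin_append, List.map_append, List.map_ofFn]
  simp [incrementList, Function.comp_def]

end Increments

/-! ### The sequence of contractions as a family over the extended natural numbers -/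

section Sequence

variable {X : Type*} [NormedAddCommGroup X] [NormedSpace ℝ X]
  {Y : ℕ → Type*} [∀ k, NormedAddCommGroup (Y k)] [∀ k, NormedSpace ℝ (Y k)] {n : ℕ} {α : ℝ} {U : Set X} {ι : ∀ k, Y (k + 1) →L[ℝ] Y k}
  {H : ℕ∞ → ∀ k, X × Y k → Y k}

/-- Convergence for each fixed `y` suffices for joint continuity, since the functions `H p k (u, ·)`
are uniformly Lipschitz. -/
theorem continuousOn_family (hH : ∀ p, ParametricContractionAssumption n α U ι (H p))
    (conv : ∀ k, 1 ≤ k → k ≤ n → ∀ y : Y k, ∀ K ⊆ U, IsCompact K →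
      TendstoUniformlyOn (fun (m : ℕ) u => H m k (u, y)) (fun u => H ⊤ k (u, y)) atTop K)
    {k : ℕ} (h1 : 1 ≤ k) (hn : k ≤ n) :
    ContinuousOn (fun q : ℕ∞ × (X × Y k) => H q.1 k q.2) (univ ×ˢ U ×ˢ univ) := by
  refine (continuousOn_of_uniform_lipschitz (S := (univ : Set ℕ∞) ×ˢ U) (α := α)
    (T := fun q y => H q.1 k (q.2, y))
    (fun q hq => (hH q.1).contraction k h1 hn q.2 hq.2)
    (fun y => continuousOn_of_tendstoUniformlyOn (f := fun p u => H p k (u, y))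
      (fun p => ((hH p).continuousOn k h1 hn).comp (f := fun u => (u, y)) (by fun_prop)
        fun u hu => ⟨hu, mem_univ _⟩)
      (conv k h1 hn y))).comp (f := fun q : ℕ∞ × (X × Y k) => ((q.1, q.2.1), q.2.2))
    (by fun_prop) fun q hq => ⟨⟨mem_univ _, hq.2.1⟩, mem_univ _⟩

theorem isGateauxFamily_fst [CompleteSpace X]
    (hH : ∀ p, ParametricContractionAssumption n α U ι (H p))
    (conv : ∀ k, 1 ≤ k → k ≤ n → ∀ y : Y k, ∀ K ⊆ U, IsCompact K →
      TendstoUniformlyOn (fun (m : ℕ) u => H m k (u, y)) (fun u => H ⊤ k (u, y)) atTop K)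
    (conv_fst : ∀ k, 1 ≤ k → k ≤ n → ∀ K ⊆ U, IsCompact K →
      ∀ C : Set X, IsCompact C → ∀ B : Set (Y k), IsCompact B →
      TendstoUniformlyOn
        (fun (m : ℕ) (p : X × X × Y k) => lineDeriv ℝ (H m k) (p.1, p.2.2) (p.2.1, 0))
        (fun p => lineDeriv ℝ (H ⊤ k) (p.1, p.2.2) (p.2.1, 0)) atTop (K ×ˢ C ×ˢ B))
    {k : ℕ} (h1 : 1 ≤ k) (hn : k ≤ n) :
    IsGateauxFamily 1 (ContinuousLinearMap.inl ℝ X (Y k)) (U ×ˢ univ) fun p => H p k := by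
  have hUV : IsOpen (U ×ˢ (univ : Set (Y k))) := (hH ⊤).isOpen.prod isOpen_univ
  have hG : ∀ p, IsGateauxFamily 1 (ContinuousLinearMap.inl ℝ X (Y k)) (U ×ˢ univ)
      fun _ : Unit => H p k := fun p =>
    (((hH p).gateaux_fst k h1 hn).isGateauxFamily hUV).mono (hH p).one_le
  refine IsGateauxFamily.of_hasLineDerivAt hUV (continuousOn_family hH conv h1 hn)
    (f' := fun q z => lineDeriv ℝ (H q.1 k) z (q.2, 0))
    (fun p z hz x => (hG p).hasLineDerivAt () hz x) (IsGateauxFamily.zero_iff.2 ?_)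
  have h2 := continuousOn_of_tendstoUniformlyOn (S := U ×ˢ (univ : Set (X × Y k)))
    (f := fun p (r : X × X × Y k) => lineDeriv ℝ (H p k) (r.1, r.2.2) (r.2.1, 0))
    (fun p => (hG p).lineDeriv.continuousOn.comp
      (f := fun r : X × X × Y k => (((), r.2.1), (r.1, r.2.2))) (by fun_prop)
      fun r hr => ⟨mem_univ _, hr.1, mem_univ _⟩)
    (fun K hKU hK => (conv_fst k h1 hn (Prod.fst '' K) (image_subset_iff.2 fun r hr => (hKU hr).1)
      (hK.image (by fun_prop)) ((fun r => r.2.1) '' K) (hK.image (by fun_prop))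
      ((fun r => r.2.2) '' K) (hK.image (by fun_prop))).mono fun r hr =>
        ⟨mem_image_of_mem _ hr, mem_image_of_mem (fun r : X × X × Y k => r.2.1) hr,
          mem_image_of_mem (fun r : X × X × Y k => r.2.2) hr⟩)
  exact h2.comp (f := fun q : (ℕ∞ × X) × (X × Y k) => (q.1.1, (q.2.1, q.1.2, q.2.2)))
    (by fun_prop) fun q hq => ⟨mem_univ _, hq.2.1, mem_univ _⟩

theorem isGateauxFamily_snd [∀ k, CompleteSpace (Y k)]
    (hH : ∀ p, ParametricContractionAssumption n α U ι (H p))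
    (conv : ∀ k, 1 ≤ k → k ≤ n → ∀ y : Y k, ∀ K ⊆ U, IsCompact K →
      TendstoUniformlyOn (fun (m : ℕ) u => H m k (u, y)) (fun u => H ⊤ k (u, y)) atTop K)
    (conv_snd : ∀ k, 1 ≤ k → k ≤ n → ∀ K ⊆ U, IsCompact K →
      ∀ B : Set (Y k), IsCompact B → ∀ B' : Set (Y k), IsCompact B' →
      TendstoUniformlyOn
        (fun (m : ℕ) (p : X × Y k × Y k) => lineDeriv ℝ (H m k) (p.1, p.2.2) (0, p.2.1))
        (fun p => lineDeriv ℝ (H ⊤ k) (p.1, p.2.2) (0, p.2.1)) atTop (K ×ˢ B ×ˢ B'))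
    {k : ℕ} (h1 : 1 ≤ k) (hn : k ≤ n) :
    IsGateauxFamily 1 (ContinuousLinearMap.inr ℝ X (Y k)) (U ×ˢ univ) fun p => H p k := by
  have hUV : IsOpen (U ×ˢ (univ : Set (Y k))) := (hH ⊤).isOpen.prod isOpen_univ
  have hG : ∀ p, IsGateauxFamily 1 (ContinuousLinearMap.inr ℝ X (Y k)) (U ×ˢ univ)
      fun _ : Unit => H p k := fun p => ((hH p).gateaux_snd k h1 hn).isGateauxFamily hUV
  refine IsGateauxFamily.of_hasLineDerivAt hUV (continuousOn_family hH conv h1 hn)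
    (f' := fun q z => lineDeriv ℝ (H q.1 k) z (0, q.2))
    (fun p z hz x => (hG p).hasLineDerivAt () hz x) (IsGateauxFamily.zero_iff.2 ?_)
  have h2 := continuousOn_of_tendstoUniformlyOn (S := U ×ˢ (univ : Set (Y k × Y k)))
    (f := fun p (r : X × Y k × Y k) => lineDeriv ℝ (H p k) (r.1, r.2.2) (0, r.2.1))
    (fun p => (hG p).lineDeriv.continuousOn.comp
      (f := fun r : X × Y k × Y k => (((), r.2.1), (r.1, r.2.2))) (by fun_prop)
      fun r hr => ⟨mem_univ _, hr.1, mem_univ _⟩)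
    (fun K hKU hK => (conv_snd k h1 hn (Prod.fst '' K) (image_subset_iff.2 fun r hr => (hKU hr).1)
      (hK.image (by fun_prop)) ((fun r => r.2.1) '' K) (hK.image (by fun_prop))
      ((fun r => r.2.2) '' K) (hK.image (by fun_prop))).mono fun r hr =>
        ⟨mem_image_of_mem _ hr, mem_image_of_mem (fun r : X × Y k × Y k => r.2.1) hr,
          mem_image_of_mem (fun r : X × Y k × Y k => r.2.2) hr⟩)
  exact h2.comp (f := fun q : (ℕ∞ × Y k) × (X × Y k) => (q.1.1, (q.2.1, q.1.2, q.2.2)))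
    (by fun_prop) fun q hq => ⟨mem_univ _, hq.2.1, mem_univ _⟩

theorem isGateauxFamily_prod [CompleteSpace X] [∀ k, CompleteSpace (Y k)]
    (hH : ∀ p, ParametricContractionAssumption n α U ι (H p))
    (conv : ∀ k, 1 ≤ k → k ≤ n → ∀ y : Y k, ∀ K ⊆ U, IsCompact K →
      TendstoUniformlyOn (fun (m : ℕ) u => H m k (u, y)) (fun u => H ⊤ k (u, y)) atTop K)
    (conv_mixed : ∀ k, 1 ≤ k → k < n → ∀ j i : ℕ, 1 ≤ j + i → j + i ≤ n →
      ∀ K ⊆ U, IsCompact K → ∀ B : Set (Y k), IsCompact B →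
      ∀ C : Fin j → Set X, (∀ l, IsCompact (C l)) →
      ∀ B' : Fin i → Set (Y (k + 1)), (∀ l, IsCompact (B' l)) →
      TendstoUniformlyOn
        (fun (m : ℕ) (p : (X × Y k) × (Fin j → X) × (Fin i → Y (k + 1))) =>
          iterDirDeriv (incrementList (ι k) p.2.1 p.2.2) (H m k) p.1)
        (fun p => iterDirDeriv (incrementList (ι k) p.2.1 p.2.2) (H ⊤ k) p.1) atTop
        ((K ×ˢ B) ×ˢ univ.pi C ×ˢ univ.pi B'))
    {k : ℕ} (h1 : 1 ≤ k) (hn : k < n) :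
    IsGateauxFamily n ((ContinuousLinearMap.id ℝ X).prodMap (ι k)) (U ×ˢ univ)
      fun p => H p k := by
  have hU : IsOpen U := (hH ⊤).isOpen
  have hUV : IsOpen (U ×ˢ (univ : Set (Y k))) := hU.prod isOpen_univ
  have hG : ∀ p, IsGateauxFamily n ((ContinuousLinearMap.id ℝ X).prodMap (ι k)) (U ×ˢ univ)
      fun _ : Unit => H p k := fun p => ((hH p).gateaux_prod k h1 hn).isGateauxFamily hUV
  have hinc : ∀ j i : ℕ, 1 ≤ j + i → j + i ≤ n → ContinuousOn
      (fun q : ℕ∞ × ((X × Y k) × (Fin j → X) × (Fin i → Y (k + 1))) =>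
        iterDirDeriv (incrementList (ι k) q.2.2.1 q.2.2.2) (H q.1 k) q.2.1)
      (univ ×ˢ (U ×ˢ univ) ×ˢ univ) := by
    intro j i hji hjin
    refine continuousOn_of_tendstoUniformlyOn (S := (U ×ˢ (univ : Set (Y k))) ×ˢ univ)
      (f := fun p (q : (X × Y k) × (Fin j → X) × (Fin i → Y (k + 1))) =>
        iterDirDeriv (incrementList (ι k) q.2.1 q.2.2) (H p k) q.1)
      (fun p => (hG p).continuousOn_incrementList hjin ()) fun K hKU hK => ?_
    refine (conv_mixed k h1 hn j i hji hjin
      ((fun q : (X × Y k) × (Fin j → X) × (Fin i → Y (k + 1)) => q.1.1) '' K)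
      (image_subset_iff.2 fun q hq => (hKU hq).1.1) (hK.image (by fun_prop))
      ((fun q => q.1.2) '' K) (hK.image (by fun_prop))
      (fun l => (fun q => q.2.1 l) '' K) (fun l => hK.image (by fun_prop))
      (fun l => (fun q => q.2.2 l) '' K) (fun l => hK.image (by fun_prop))).mono fun q hq => ?_
    exact ⟨⟨⟨q, hq, rfl⟩, ⟨q, hq, rfl⟩⟩, fun l _ => ⟨q, hq, rfl⟩, fun l _ => ⟨q, hq, rfl⟩⟩
  intro j hj
  refine ⟨fun p v => (hG p j hj).1 () v, ?_⟩
  rcases Nat.eq_zero_or_pos j with rfl | hj0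
  · have h0 : IsGateauxFamily 0 ((ContinuousLinearMap.id ℝ X).prodMap (ι k)) (U ×ˢ univ)
        fun p => H p k := IsGateauxFamily.zero_iff.2 (continuousOn_family hH conv h1 hn.le)
    exact (h0 0 le_rfl).2
  -- The derivative is a sum of derivatives with sorted increments, indexed by the set `s` of those
  -- slots in which the `X`-component of the increment is used.
  · refine ContinuousOn.congr (continuousOn_finsetSum (Finset.univ : Finset (Finset (Fin j)))
      (fun s _ => ?_)) (fun q hq =>
        ((hG q.1.1).hasContinuousDirDerivs ()).eq_sum_incrementList hU hj hq.1.2 q.2)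
    have hcard : s.card + sᶜ.card = j := by rw [Finset.card_add_card_compl, Fintype.card_fin]
    exact (hinc s.card sᶜ.card (by omega) (by omega)).comp
      (f := fun q : (ℕ∞ × (X × Y k)) × (Fin j → X × Y (k + 1)) => (q.1.1, (q.1.2,
        (fun l => (q.2 (s.orderEmbOfFin rfl l)).1), fun l => (q.2 (sᶜ.orderEmbOfFin rfl l)).2)))
      (by fun_prop) fun q hq => ⟨mem_univ _, hq.1.2, mem_univ _⟩

end Sequence

theorem proposition2p14
    {X : Type*} [NormedAddCommGroup X] [NormedSpace ℝ X] [CompleteSpace X]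
    {Y : ℕ → Type*} [∀ k, NormedAddCommGroup (Y k)] [∀ k, NormedSpace ℝ (Y k)]
    [∀ k, CompleteSpace (Y k)]
    (n : ℕ) (α : ℝ) (U : Set X) (ι : ∀ k, Y (k + 1) →L[ℝ] Y k)
    -- the functions `h_k`, `h_k^{(m)}` induced by `h_1`, `h_1^{(m)}`
    (h : ∀ k, X × Y k → Y k) (hm : ℕ → ∀ k, X × Y k → Y k)
    (hh : ParametricContractionAssumption n α U ι h)
    (hhm : ∀ m, ParametricContractionAssumption n α U ι (hm m))
    -- the fixed-point maps of `h_1`, `h_1^{(m)}`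
    (φ : X → Y 1) (φm : ℕ → X → Y 1)
    (hφ : ∀ u ∈ U, h 1 (u, φ u) = φ u)
    (hφm : ∀ m, ∀ u ∈ U, hm m 1 (u, φm m u) = φm m u)
    -- convergence of `h_k^{(m)}` for fixed `y`
    (conv : ∀ k, 1 ≤ k → k ≤ n → ∀ y : Y k, ∀ K ⊆ U, IsCompact K →
      TendstoUniformlyOn (fun m u => hm m k (u, y)) (fun u => h k (u, y)) atTop K)
    -- convergence of the first derivatives with increments in `X` and in `Y_k`
    (conv_fst : ∀ k, 1 ≤ k → k ≤ n → ∀ K ⊆ U, IsCompact K →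
      ∀ C : Set X, IsCompact C → ∀ B : Set (Y k), IsCompact B →
      TendstoUniformlyOn
        (fun m (p : X × X × Y k) => lineDeriv ℝ (hm m k) (p.1, p.2.2) (p.2.1, 0))
        (fun p => lineDeriv ℝ (h k) (p.1, p.2.2) (p.2.1, 0)) atTop (K ×ˢ C ×ˢ B))
    (conv_snd : ∀ k, 1 ≤ k → k ≤ n → ∀ K ⊆ U, IsCompact K →
      ∀ B : Set (Y k), IsCompact B → ∀ B' : Set (Y k), IsCompact B' →
      TendstoUniformlyOn
        (fun m (p : X × Y k × Y k) => lineDeriv ℝ (hm m k) (p.1, p.2.2) (0, p.2.1))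
        (fun p => lineDeriv ℝ (h k) (p.1, p.2.2) (0, p.2.1)) atTop (K ×ˢ B ×ˢ B'))
    -- convergence of the derivatives with increments in `X` and in `Y_{k+1}`
    (conv_mixed : ∀ k, 1 ≤ k → k < n → ∀ j i : ℕ, 1 ≤ j + i → j + i ≤ n →
      ∀ K ⊆ U, IsCompact K → ∀ B : Set (Y k), IsCompact B →
      ∀ C : Fin j → Set X, (∀ l, IsCompact (C l)) →
      ∀ B' : Fin i → Set (Y (k + 1)), (∀ l, IsCompact (B' l)) →
      TendstoUniformlyOn
        (fun m (p : (X × Y k) × (Fin j → X) × (Fin i → Y (k + 1))) =>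
          iterDirDeriv (incrementList (ι k) p.2.1 p.2.2) (hm m k) p.1)
        (fun p => iterDirDeriv (incrementList (ι k) p.2.1 p.2.2) (h k) p.1) atTop
        ((K ×ˢ B) ×ˢ univ.pi C ×ˢ univ.pi B')) :
    -- `Φ k`, `Φm m k` are `φ`, `φ^{(m)}` as functions with values in `Y_k`
    ∃ (Φ : ∀ k, X → Y k) (Φm : ℕ → ∀ k, X → Y k),
      (∀ u ∈ U, Φ 1 u = φ u ∧ ∀ k, 1 ≤ k → k < n → ι k (Φ (k + 1) u) = Φ k u) ∧
      (∀ m, ∀ u ∈ U, Φm m 1 u = φm m u ∧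
        ∀ k, 1 ≤ k → k < n → ι k (Φm m (k + 1) u) = Φm m k u) ∧
      (∀ K ⊆ U, IsCompact K →
        TendstoUniformlyOn (fun m u => Φm m n u) (Φ n) atTop K) ∧
      ∀ j, 1 ≤ j → j ≤ n →
        IsStronglyGateaux j (ContinuousLinearMap.id ℝ X) U (Φ (n - j + 1)) ∧
        (∀ m, IsStronglyGateaux j (ContinuousLinearMap.id ℝ X) U (Φm m (n - j + 1))) ∧
        ∀ K ⊆ U, IsCompact K → ∀ C : Fin j → Set X, (∀ l, IsCompact (C l)) →
          TendstoUniformlyOn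
            (fun m (p : X × (Fin j → X)) =>
              iterDirDeriv (List.ofFn p.2) (Φm m (n - j + 1)) p.1)
            (fun p => iterDirDeriv (List.ofFn p.2) (Φ (n - j + 1)) p.1) atTop
            (K ×ˢ univ.pi C) := by
  set H : ℕ∞ → ∀ k, X × Y k → Y k :=
    fun p => ENat.recTopCoe (C := fun _ => ∀ k, X × Y k → Y k) h hm p
  have hH : ∀ p, ParametricContractionAssumption n α U ι (H p) := fun p => by
    induction p using ENat.recTopCoe with
    | top => exact hh
    | coe m => exact hhm m
  have hU : IsOpen U := hh.isOpen
  have hn : 1 ≤ n := hh.one_le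
  have h0 := hh.alpha_nonneg
  have hα := hh.alpha_lt_one
  have hex : ∀ (p : ℕ∞) (k : ℕ) (u : X), ∃ a : Y k,
      1 ≤ k → k ≤ n → u ∈ U → H p k (u, a) = a := fun p k u => by
    by_cases hk : 1 ≤ k ∧ k ≤ n ∧ u ∈ U
    · obtain ⟨a, ha⟩ := exists_fixed_of_contraction h0 hα
        ((hH p).contraction k hk.1 hk.2.1 u hk.2.2)
      exact ⟨a, fun _ _ _ => ha⟩
    · exact ⟨0, fun h1 h2 h3 => absurd ⟨h1, h2, h3⟩ hk⟩
  choose Φ hΦ using hex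
  have hι : ∀ p, ∀ u ∈ U, ∀ k, 1 ≤ k → k < n → ι k (Φ p (k + 1) u) = Φ p k u := by
    intro p u hu k h1 hk
    refine eq_of_contraction hα ((hH p).contraction k h1 hk.le u hu) ?_ (hΦ p k u h1 hk.le hu)
    rw [← (hH p).induced k h1 hk u hu, hΦ p (k + 1) u (by omega) (by omega) hu]
  -- `ULift` puts the parameters into a universe in which products with `X` and `Y k` stay.
  have hfam : ∀ j k : ℕ, k + j = n + 1 → 1 ≤ j → 1 ≤ k →
      IsGateauxFamily j (ContinuousLinearMap.id ℝ X) U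
        fun p : ULift.{max u_1 u_2} ℕ∞ => Φ p.down k := by
    intro j
    induction j with
    | zero => omega
    | succ j ih =>
      intro k hkj _ hk
      have hkn : k ≤ n := by omega
      have hfst := (isGateauxFamily_fst hH conv conv_fst hk hkn).comp_param
        (continuous_uliftDown (X := ℕ∞) : Continuous (ULift.down.{max u_1 u_2}))
      have hsnd := (isGateauxFamily_snd hH conv conv_snd hk hkn).comp_param
        (continuous_uliftDown (X := ℕ∞) : Continuous (ULift.down.{max u_1 u_2}))
      have hcontr : ∀ (p : ULift.{max u_1 u_2} ℕ∞), ∀ u ∈ U, ∀ y y',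
          ‖H p.down k (u, y) - H p.down k (u, y')‖ ≤ α * ‖y - y'‖ := fun p =>
        (hH p.down).contraction k hk hkn
      cases j with
      | zero =>
        exact (isGateauxFamily_one_fixed hU h0 hα hcontr hfst hsnd
          fun p u hu => hΦ p.down k u hk hkn hu).1
      | succ j =>
        have hkn' : k < n := by omega
        have hprod := (isGateauxFamily_prod hH conv conv_mixed hk hkn').comp_param
          (continuous_uliftDown (X := ℕ∞) : Continuous (ULift.down.{max u_1 u_2}))
        exact isGateauxFamily_succ_fixed.{0, u_1, u_2, u_2} hU h0 hα hcontr hfst hsnd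
          (hprod.mono (by omega)) (fun p u hu => hΦ p.down k u hk hkn hu)
          (fun p u hu => hι p.down u hu k hk hkn') (ih (k + 1) (by omega) (by omega) (by omega))
  have hfam' : ∀ j k : ℕ, k + j = n + 1 → 1 ≤ j → 1 ≤ k →
      IsGateauxFamily j (ContinuousLinearMap.id ℝ X) U fun p : ℕ∞ => Φ p k := fun j k h1 h2 h3 =>
    (hfam j k h1 h2 h3).comp_param
      (continuous_uliftUp (X := ℕ∞) : Continuous (ULift.up.{max u_1 u_2}))
  refine ⟨Φ ⊤, fun m => Φ m, fun u hu => ⟨?_, hι ⊤ u hu⟩, fun m u hu => ⟨?_, hι m u hu⟩, ?_, ?_⟩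
  · exact eq_of_contraction hα (hh.contraction 1 le_rfl hn u hu) (hΦ ⊤ 1 u le_rfl hn hu) (hφ u hu)
  · exact eq_of_contraction hα ((hhm m).contraction 1 le_rfl hn u hu) (hΦ m 1 u le_rfl hn hu)
      (hφm m u hu)
  · intro K hKU hK
    exact tendstoUniformlyOn_of_continuousOn (f := fun p => Φ p n) hK
      ((hfam' 1 n rfl le_rfl hn).continuousOn.mono (prod_mono_right hKU))
  · intro j hj hjn
    have hG := hfam' j (n - j + 1) (by omega) hj (by omega)
    refine ⟨hG.isStronglyGateaux hU ⊤, fun m => hG.isStronglyGateaux hU m, ?_⟩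
    intro K hKU hK C hC
    refine tendstoUniformlyOn_of_continuousOn
      (f := fun p (q : X × (Fin j → X)) => iterDirDeriv (List.ofFn q.2) (Φ p (n - j + 1)) q.1)
      (hK.prod (isCompact_univ_pi hC)) ?_
    exact (hG j le_rfl).2.comp (f := fun q : ℕ∞ × (X × (Fin j → X)) => ((q.1, q.2.1), q.2.2))
      (by fun_prop) fun q hq => ⟨⟨mem_univ _, hKU hq.2.1⟩, mem_univ _⟩
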